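/- Let $k$ be an algebraically closed field, let $\mathcal A$ be a $k$-linear, $\mathrm{Hom}$-finite, hereditary abelian category (i.e. $\mathrm{Ext}^i=0$ for $i\ge 2$), and let $\sigma=(\mathcal P,Z)$ be a locally finite Bridgeland stability condition on $\mathcal T=D^b(\mathcal A)$. For $X$ in $\mathcal A$ or $\mathcal T$ let $\mathrm{Ind}(X)$ be the class of indecomposable direct summands of $X$. "Semistable" means nonzero and in some $\mathcal P(t)$. An object $E\in\mathcal T$ is exceptional if $\mathrm{Hom}(E,E)=k$ and $\mathrm{Hom}(E,E[i])=0$ for $i\neq 0$. A pair $(S,E)$ of exceptional objects is exceptional if $\mathrm{Hom}(E,S[p])=0$ for all $p\in\mathbb Z$. It is a $\sigma$-exceptional pair if moreover $S$ and $E$ are semistable, $\mathrm{Hom}(S,E[p])=\mathrm{Hom}(E,S[p])=0$ for all $p\le 0$, and the phases of $S$ and $E$ both lie in $(t,t+1]$ for some $t\in\mathbb R$. Let $R\in\mathcal T$ be a non-semistable exceptional object; write $R\cong L[j]$ with $L\in\mathcal A$, $j\in\mathbb Z$. Let $X\to R\to\sigma_-(R)\to X[1]$ be the last triangle of the Harder–Narasimhan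 filtration of $R$ ($\sigma_-(R)$ is the factor of minimal phase). Then $\sigma_-(R)\cong B_0[j]\oplus B_1[j+1]$ with $B_0,B_1\in\mathcal A$; let $f_0:L\to B_0$ be the corresponding component of $R\to\sigma_-(R)$. The triangle $\mathfrak{alg}(R):\ U\to R\to V\to U[1]$ is the last Harder–Narasimhan triangle above if $B_0=0$, and is the triangle on the arrow $f_0[j]:R\to B_0[j]=V$ if $B_0\ne 0$. The object $R$ is called $\sigma$-regular if one of the following holds: * (C1) $B_0\neq 0$ and $\mathrm{coker}(f_0)=0$; * (C2) $B_0\ne0$, $\mathrm{coker}(f_0)\neq0$, and $\mathrm{Ext}^1(L,\Gamma)=0$ for every $\Gamma\in\mathrm{Ind}(\mathrm{coker}(f_0))$; * (C3) $B_0=0$ and $\mathrm{Ext}^1(\Gamma,L)=0$ for every $\Gamma\in\mathrm{Ind}(B_1)$. For a $\sigma$-regular $R$ write $R\dashrightarrow(S,E)$ if $S\in\mathrm{Ind}(V)$ and $E\in\mathrm{Ind}(U)$. A $\sigma$-regular $R$ is final if every object of $\mathrm{Ind}(U)$ is semistable. The category $\mathcal A$ is regularity-preserving if for every locally finite stability condition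 $\sigma'$ on $D^b(\mathcal A)$, whenever $R$ is $\sigma'$-regular, $R\dashrightarrow(S,E)$ (with respect to $\sigma'$) and $E$ is not $\sigma'$-semistable, $E$ is $\sigma'$-regular. Then: 1. Let $R$ be a final $\sigma$-regular object. There are $S,E$ with $R\dashrightarrow(S,E)$, and for all such $S,E$ there is an integer $i\geq 1$ such that $(S,E[-i])$ is a $\sigma$-exceptional pair. In particular, a final $\sigma$-regular object yields a $\sigma$-exceptional pair. 2. Suppose that $\mathcal A$ is regularity-preserving. For every $\sigma$-regular object $R$ there is a finite (possibly empty) sequence of steps $R\dashrightarrow(S_1,E_1)$, $E_1\dashrightarrow(S_2,E_2)$, …, $E_{n-1}\dashrightarrow(S_n,E_n)$ whose last object $R'=E_n$ ($R'=R$ if $n=0$) is a final $\sigma$-regular object, and there are $S,E$ with $R'\dashrightarrow(S,E)$ and an integer $i\ge1$ such that $(S,E[-i])$ is a $\sigma$-exceptional pair. In particular, every $\sigma$-regular object induces a $\sigma$-exceptional pair. -/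

import Mathlib

open CategoryTheory CategoryTheory.Limits CategoryTheory.Pretriangulated

universe t w v u

noncomputable section

namespace StabExc

/-! ### Generalities on additive and triangulated categories -/

/-- `Y ∈ Ind(X)`: the object `Y` is an indecomposable direct summand of `X`. -/
def IsIndSummand {C : Type u} [Category.{v} C] [HasZeroMorphisms C] [HasBinaryBiproducts C]
    (Y X : C) : Prop :=
  Indecomposable Y ∧ ∃ Z : C, Nonempty (X ≅ Y ⊞ Z)

section Triangulated

variable (k : Type t) [Field k] {T : Type u} [Category.{v} T] [Preadditive T] [HasZeroObject T]
  [HasShift T ℤ] [∀ n : ℤ, (shiftFunctor T n).Additive] [Pretriangulated T]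

/-- `Hom^i(X, Y) = Hom(X, Y[i])` vanishes. -/
def HomVanishes {T : Type u} [Category.{v} T] [Preadditive T] [HasShift T ℤ]
    (X Y : T) (i : ℤ) : Prop :=
  ∀ f : X ⟶ Y⟦i⟧, f = 0

/-- `E` is exceptional: `Hom^i(E, E) = 0` for `i ≠ 0` and `Hom(E, E)` is one-dimensional. -/
def IsExceptional {T : Type u} [Category.{v} T] [Preadditive T] [HasShift T ℤ] [Linear k T]
    (E : T) : Prop :=
  (∀ i : ℤ, i ≠ 0 → HomVanishes E E i) ∧ Module.finrank k (E ⟶ E) = 1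

/-- `(E₀, …, E_{n-1})` is an exceptional collection: the members are exceptional and
`Hom^*(E_j, E_i) = 0` for `i < j`. -/
def IsExceptionalCollection {T : Type u} [Category.{v} T] [Preadditive T] [HasShift T ℤ]
    [Linear k T] {n : ℕ} (E : Fin n → T) : Prop :=
  (∀ i, IsExceptional k (E i)) ∧ ∀ i j, i < j → ∀ p : ℤ, HomVanishes (E j) (E i) p

/-- The relations `[X₂] = [X₁] + [X₃]` for distinguished triangles `X₁ → X₂ → X₃ → X₁[1]`. -/
def K0Relations (T : Type u) [Category.{v} T] [Preadditive T] [HasZeroObject T]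
    [HasShift T ℤ] [∀ n : ℤ, (shiftFunctor T n).Additive] [Pretriangulated T] :
    AddSubgroup (FreeAbelianGroup T) :=
  AddSubgroup.closure
    {z | ∃ D ∈ distTriang T, z = FreeAbelianGroup.of D.obj₂ -
      (FreeAbelianGroup.of D.obj₁ + FreeAbelianGroup.of D.obj₃)}

/-- The Grothendieck group of a triangulated category. -/
abbrev K0 (T : Type u) [Category.{v} T] [Preadditive T] [HasZeroObject T]
    [HasShift T ℤ] [∀ n : ℤ, (shiftFunctor T n).Additive] [Pretriangulated T] : Type u :=
  FreeAbelianGroup T ⧸ K0Relations T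

/-- The class of an object in the Grothendieck group. -/
def K0.mk (X : T) : K0 T := QuotientAddGroup.mk (FreeAbelianGroup.of X)

/-! ### Stability conditions -/

/-- A Harder-Narasimhan filtration of `X` with respect to a family `P` of full subcategories:
triangles `E_i → E_{i+1} → A_i → E_i[1]`, `0 ≤ i ≤ m`, with `E_0 = 0`, `E_{m+1} ≅ X`, nonzero
`A_i ∈ P(t_i)` and `t_0 > t_1 > … > t_m`. -/
structure HNFiltration (P : ℝ → ObjectProperty T) (X : T) where
  m : ℕ
  obj : Fin (m + 2) → T
  factor : Fin (m + 1) → T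
  phase : Fin (m + 1) → ℝ
  map : ∀ i : Fin (m + 1), obj i.castSucc ⟶ obj i.succ
  proj : ∀ i : Fin (m + 1), obj i.succ ⟶ factor i
  conn : ∀ i : Fin (m + 1), factor i ⟶ (obj i.castSucc)⟦(1 : ℤ)⟧
  distinguished : ∀ i, Triangle.mk (map i) (proj i) (conn i) ∈ distTriang T
  isZero_zero : IsZero (obj 0)
  topIso : obj (Fin.last m).succ ≅ X
  factor_mem : ∀ i, P (phase i) (factor i)
  factor_nonzero : ∀ i, ¬ IsZero (factor i)
  phase_strictAnti : StrictAnti phase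

namespace HNFiltration

variable {P : ℝ → ObjectProperty T} {X : T} (F : HNFiltration P X)

/-- The Harder-Narasimhan factor of minimal phase, `σ_-(X)`. -/
def minFactor : T := F.factor (Fin.last F.m)

/-- The second arrow `X → σ_-(X)` of the last triangle of the filtration. -/
def toMinFactor : X ⟶ F.minFactor := F.topIso.inv ≫ F.proj (Fin.last F.m)

end HNFiltration

/-- `P(I)`: the extension closure of the subcategories `P(t)`, `t ∈ I`. -/
inductive ExtClosure (P : ℝ → ObjectProperty T) (I : Set ℝ) : T → Prop
  | of_mem {s : ℝ} {X : T} (hs : s ∈ I) (hX : P s X) : ExtClosure P I X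
  | ext {D : Triangle T} (hD : D ∈ distTriang T) (h₁ : ExtClosure P I D.obj₁)
      (h₃ : ExtClosure P I D.obj₃) : ExtClosure P I D.obj₂

/-- `f : X ⟶ Y` is a strict monomorphism of the quasi-abelian category `P(I)` (with `I` an interval
of length less than one), i.e. it is the first arrow of a triangle with vertices in `P(I)`. -/
def IsStrictMono (P : ℝ → ObjectProperty T) (I : Set ℝ) {X Y : T} (f : X ⟶ Y) : Prop :=
  ExtClosure P I X ∧ ExtClosure P I Y ∧
    ∃ (Z : T) (g : Y ⟶ Z) (h : Z ⟶ X⟦(1 : ℤ)⟧),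
      ExtClosure P I Z ∧ Triangle.mk f g h ∈ distTriang T

/-- The quasi-abelian category `P(I)` has finite length: ascending and descending chains of strict
subobjects of any object stabilize. -/
def IsFiniteLength (P : ℝ → ObjectProperty T) (I : Set ℝ) : Prop :=
  ∀ (X : T) (Y : ℕ → T) (j : ∀ n, Y n ⟶ X), (∀ n, IsStrictMono P I (j n)) →
    (∀ a : ∀ n, Y n ⟶ Y (n + 1), (∀ n, a n ≫ j (n + 1) = j n) →
      ∃ N, ∀ n, N ≤ n → IsIso (a n)) ∧
    (∀ d : ∀ n, Y (n + 1) ⟶ Y n, (∀ n, d n ≫ j n = j (n + 1)) →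
      ∃ N, ∀ n, N ≤ n → IsIso (d n))

variable (T) in
/-- A (Bridgeland) locally finite stability condition `σ = (P, Z)` on `T`. -/
structure StabilityCondition where
  /-- the subcategory `P(t)` of semistable objects of phase `t` (together with the zero objects) -/
  P : ℝ → ObjectProperty T
  /-- the central charge -/
  Z : K0 T →+ ℂ
  P_iso : ∀ (s : ℝ) {X Y : T}, (X ≅ Y) → P s X → P s Y
  P_zero : ∀ (s : ℝ) {X : T}, IsZero X → P s X
  P_biprod : ∀ (s : ℝ) {X Y : T}, P s X → P s Y → P s (X ⊞ Y)
  P_shift : ∀ (s : ℝ) (X : T), P (s + 1) (X⟦(1 : ℤ)⟧) ↔ P s X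
  hom_eq_zero : ∀ {s₁ s₂ : ℝ} {X Y : T}, s₂ < s₁ → P s₁ X → P s₂ Y → ∀ f : X ⟶ Y, f = 0
  exists_HN : ∀ X : T, ¬ IsZero X → Nonempty (HNFiltration P X)
  charge : ∀ (s : ℝ) (X : T), P s X → ¬ IsZero X →
    ∃ r : ℝ, 0 < r ∧ Z (K0.mk X) = r * Complex.exp (Real.pi * s * Complex.I)
  locallyFinite : ∃ η : ℝ, 0 < η ∧ η < 1 / 2 ∧
    ∀ s : ℝ, IsFiniteLength P (Set.Ioo (s - η) (s + η))

/-- `X ∈ σ^ss`: the object `X` is nonzero and lies in some `P(t)`. -/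
def IsSemistable (σ : StabilityCondition T) (X : T) : Prop :=
  ¬ IsZero X ∧ ∃ s : ℝ, σ.P s X

/-- A `σ`-exceptional collection: an exceptional collection of semistable objects with
`Hom^{≤ 0}(E_i, E_j) = 0` for `i ≠ j` and all phases in some interval `(s, s + 1]`. -/
def IsSigmaExceptionalCollection [Linear k T] (σ : StabilityCondition T) {n : ℕ}
    (E : Fin n → T) : Prop :=
  IsExceptionalCollection k E ∧
  (∀ i, IsSemistable σ (E i)) ∧
  (∀ i j, i ≠ j → ∀ p : ℤ, p ≤ 0 → HomVanishes (E i) (E j) p) ∧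
  ∃ (s : ℝ) (φ : Fin n → ℝ), ∀ i, σ.P (φ i) (E i) ∧ φ i ∈ Set.Ioc s (s + 1)

/-- `(S, E)` is a `σ`-exceptional pair. -/
def IsSigmaExceptionalPair [Linear k T] (σ : StabilityCondition T) (S E : T) : Prop :=
  IsSigmaExceptionalCollection k σ ![S, E]

end Triangulated

/-! ### The bounded derived category of a hereditary category and the algorithm `alg` -/

section Derived

variable (k : Type t) [Field k] {A : Type u} [Category.{v} A] [Abelian A]
  [HasDerivedCategory.{w} A]

variable (A) in
/-- The bounded derived category `D^b(A)`. -/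
abbrev Db : Type (max u v) := DerivedCategory.Bounded A

variable (A) in
/-- The embedding `A → D^b(A)` as complexes concentrated in degree `0`. -/
def single : A ⥤ Db A :=
  ObjectProperty.lift _ (DerivedCategory.singleFunctor A 0) (fun _ =>
    ⟨⟨0, inferInstance⟩, ⟨0, inferInstance⟩⟩)

variable (A) in
/-- The embedding `A → D^b(A)`, `X ↦ X[j]`. -/
abbrev shifted (j : ℤ) : A ⥤ Db A := single A ⋙ shiftFunctor (Db A) j

variable (A) in
/-- `A` is hereditary: `Ext^i(X, Y) = Hom_{D^b(A)}(X, Y[i]) = 0` for all `i ≥ 2`. -/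
def IsHereditary : Prop :=
  ∀ (X Y : A) (i : ℤ), 2 ≤ i → HomVanishes ((single A).obj X) ((single A).obj Y) i

/-- The triangle `alg(R)`, for an object `R ≅ L[j]`, `L ∈ A`. One takes the last triangle
`X → R → σ_-(R) → X[1]` of a Harder-Narasimhan filtration of `R`, where
`σ_-(R) ≅ B₀[j] ⊕ B₁[j+1]`, `B₀, B₁ ∈ A`, and the component `f₀ : L → B₀` of `R → σ_-(R)`.
If `B₀ = 0`, then `alg(R) : U → R → V → U[1]` is that last triangle, so `V = σ_-(R) ≅ B₁[j+1]`.
If `B₀ ≠ 0`, then `alg(R)` is the triangle on the arrow `f₀[j] : R → B₀[j] = V`; then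
`U ≅ ker(f₀)[j] ⊕ coker(f₀)[j-1]`. All the choices are unique up to isomorphism. -/
structure AlgTriangle (σ : StabilityCondition (Db A)) (R : Db A) where
  filtration : HNFiltration σ.P R
  j : ℤ
  L : A
  B₀ : A
  B₁ : A
  isoL : R ≅ (shifted A j).obj L
  isoMin : filtration.minFactor ≅ (shifted A j).obj B₀ ⊞ (shifted A (j + 1)).obj B₁
  f₀ : L ⟶ B₀
  comm : isoL.hom ≫ (shifted A j).map f₀ = filtration.toMinFactor ≫ isoMin.hom ≫ biprod.fst
  U : Db A
  V : Db A
  u : U ⟶ R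
  v : R ⟶ V
  w : V ⟶ U⟦(1 : ℤ)⟧
  distinguished : Triangle.mk u v w ∈ distTriang (Db A)
  eq_of_isZero : IsZero B₀ →
    ∃ g : V ≅ filtration.minFactor, v ≫ g.hom = filtration.toMinFactor
  eq_of_not_isZero : ¬ IsZero B₀ →
    ∃ g : V ≅ (shifted A j).obj B₀, v ≫ g.hom = isoL.hom ≫ (shifted A j).map f₀

namespace AlgTriangle

variable {σ : StabilityCondition (Db A)} {R : Db A} (D : AlgTriangle σ R)

/-- Case C1: `B₀ ≠ 0` and `f₀` is an epimorphism. -/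
def IsC1 : Prop := ¬ IsZero D.B₀ ∧ IsZero (cokernel D.f₀)

/-- Case C2: `B₀ ≠ 0`, `A₂ = coker(f₀) ≠ 0`, and `Ext¹(L, Γ) = 0` for all `Γ ∈ Ind(A₂)`
(otherwise one is in the irregular case B1). -/
def IsC2 : Prop :=
  ¬ IsZero D.B₀ ∧ ¬ IsZero (cokernel D.f₀) ∧
    ∀ Γ : A, IsIndSummand Γ (cokernel D.f₀) →
      HomVanishes ((single A).obj D.L) ((single A).obj Γ) 1

/-- Case C3: `B₀ = 0` and `Ext¹(Γ, L) = 0` for all `Γ ∈ Ind(B₁)`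
(otherwise one is in the irregular case B2). -/
def IsC3 : Prop :=
  IsZero D.B₀ ∧
    ∀ Γ : A, IsIndSummand Γ D.B₁ →
      HomVanishes ((single A).obj Γ) ((single A).obj D.L) 1

/-- The triangle is of one of the regular types C1, C2, C3. -/
def IsRegularType : Prop := D.IsC1 ∨ D.IsC2 ∨ D.IsC3

end AlgTriangle

variable [Linear k A]

/-- `R` is a `σ`-regular object: a non-semistable exceptional object such that `alg(R)` is of type
C1, C2 or C3. -/
def IsRegular (σ : StabilityCondition (Db A)) (R : Db A) : Prop :=
  IsExceptional k R ∧ ¬ IsSemistable σ R ∧ ∃ D : AlgTriangle σ R, D.IsRegularType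

/-- The relation `R ⇢ (S, E)`: `R` is `σ`-regular, `S ∈ Ind(V)` and `E ∈ Ind(U)`, where `U` and `V`
are the vertices of the triangle `alg(R) : U → R → V → U[1]`. -/
def Yields (σ : StabilityCondition (Db A)) (R S E : Db A) : Prop :=
  IsRegular k σ R ∧ ∃ D : AlgTriangle σ R, D.IsRegularType ∧
    IsIndSummand S D.V ∧ IsIndSummand E D.U

/-- A `σ`-regular object `R` is final if all indecomposable components of the vertex `U` of
`alg(R)` are semistable. -/
def IsFinal (σ : StabilityCondition (Db A)) (R : Db A) : Prop :=
  IsRegular k σ R ∧ ∃ D : AlgTriangle σ R, D.IsRegularType ∧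
    ∀ Γ : Db A, IsIndSummand Γ D.U → IsSemistable σ Γ

variable (A) in
/-- `A` is regularity-preserving: for every stability condition `σ`, if `R` is `σ`-regular,
`R ⇢ (S, E)` and `E` is not semistable, then `E` is `σ`-regular. -/
def IsRegularityPreserving : Prop :=
  ∀ (σ : StabilityCondition (Db A)) (R S E : Db A),
    IsRegular k σ R → Yields k σ R S E → ¬ IsSemistable σ E → IsRegular k σ E

/-- `R'` is reached from `R` by finitely many (possibly no) steps `R ⇢ (S₁, E₁)`,
`E₁ ⇢ (S₂, E₂)`, …, `E_{n-1} ⇢ (S_n, E_n)` with `E_n = R'`. -/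
def Reaches (σ : StabilityCondition (Db A)) (R R' : Db A) : Prop :=
  Relation.ReflTransGen (fun X Y => ∃ S : Db A, Yields k σ X S Y) R R'

end Derived

end StabExc

end

noncomputable section

namespace StabExc

/-! ### Vanishing of graded Hom groups and long exact sequences -/

section HomVanishes

variable {T : Type u} [Category.{v} T] [Preadditive T] [HasShift T ℤ]

/-! The proof feeds the long exact Hom sequences of `alg(R) : U → R → V` with two sources of
vanishing: phases, and degrees, since over a hereditary category shifts of objects of `A` only
interact in degrees 0 and 1.

Pairs. The octahedral axiom gives a triangle X → U → W, where X collects the Harder–Narasimhan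
factors of R of phase greater than that of σ_-(R), and W is zero or, only when V ≅ B₀[j], equal to
B₁[j+1]. Phases on X and degrees on W give Hom^{≤0}(U,V) = 0 (`homVanishes_U_V`). Regularity
supplies the two inputs that degrees do not: Ext¹(L,B₀) = 0 in cases C1 and C2, Ext¹(B₁,L) = 0 in
case C3. Then all of Hom^*(U,V), Hom¹(U,U), Hom¹(V,V) and Hom^{<0}(V,U) vanish
(`homVanishes_of_triangle`, `homVanishes_of_isRegularType`). Indecomposable summands of U and V are
shifts of objects of `A`; having no self-extensions, they are exceptional by the Happel–Ringel
argument (`isIso_endo_of_homVanishes`) and because k is algebraically closed. A semistable summand E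
of U has larger phase than V (`phase_lt_of_retract_U`), so some E[-i] with i ≥ 1 has phase within
the half-open unit interval ending at the phase of V, and Hom^{<0}(V,U) = 0 gives the remaining
vanishing.

Termination. If E is a summand of U, its phases are among those of R. The number of phases may fail
to drop only if the lowest phase survives through W = B₁[j+1]; this needs B₀ ≠ 0 for R and forces B₀
= 0 for E (`ncard_phaseSupport_lt`). Hence 2·#phases + [B₀ ≠ 0] strictly decreases along the steps.
-/

lemma HomVanishes.of_retract {X Y X' Y' : T} {n : ℤ} (h : HomVanishes X Y n)
    (hX : Retract X' X) (hY : Retract Y' Y) : HomVanishes X' Y' n := by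
  intro f
  have e : f = hX.i ≫ (hX.r ≫ f ≫ hY.i⟦n⟧') ≫ hY.r⟦n⟧' := by
    simp [← Functor.map_comp]
  rw [e, h (hX.r ≫ f ≫ hY.i⟦n⟧')]
  simp

lemma HomVanishes.of_iso {X Y X' Y' : T} {n : ℤ} (h : HomVanishes X Y n)
    (hX : X ≅ X') (hY : Y ≅ Y') : HomVanishes X' Y' n :=
  h.of_retract (.ofIso hX.symm) (.ofIso hY.symm)

lemma homVanishes_of_isZero_left {X : T} (hX : IsZero X) (Y : T) (n : ℤ) : HomVanishes X Y n :=
  fun _ => hX.eq_of_src _ _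

lemma homVanishes_zero_iff {X Y : T} : HomVanishes X Y 0 ↔ ∀ f : X ⟶ Y, f = 0 := by
  constructor
  · intro h f
    rw [← cancel_mono ((shiftFunctorZero T ℤ).inv.app Y)]
    simpa using h (f ≫ (shiftFunctorZero T ℤ).inv.app Y)
  · intro h f
    rw [← cancel_mono ((shiftFunctorZero T ℤ).hom.app Y)]
    simpa using h (f ≫ (shiftFunctorZero T ℤ).hom.app Y)

lemma homVanishes_shift_right_iff {X Y : T} (b q n : ℤ) (h : b + q = n) :
    HomVanishes X (Y⟦b⟧) q ↔ HomVanishes X Y n := by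
  let e := (shiftFunctorAdd' T b q n h).app Y
  constructor
  · intro H f
    rw [← cancel_mono e.hom]
    simpa using H (f ≫ e.hom)
  · intro H f
    rw [← cancel_mono e.inv]
    simpa using H (f ≫ e.inv)

variable [∀ n : ℤ, (shiftFunctor T n).Additive]

lemma homVanishes_of_isZero_right (X : T) {Y : T} (hY : IsZero Y) (n : ℤ) : HomVanishes X Y n :=
  fun _ => ((shiftFunctor T n).map_isZero hY).eq_of_tgt _ _

lemma homVanishes_shift_left_iff {X Y : T} (a q n : ℤ) (h : n + a = q) :
    HomVanishes (X⟦a⟧) Y q ↔ HomVanishes X Y n := by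
  let e := (shiftFunctorAdd' T n a q h).app Y
  constructor
  · intro H f
    apply (shiftFunctor T a).map_injective
    rw [← cancel_mono e.inv]
    simpa using H (f⟦a⟧' ≫ e.inv)
  · intro H f
    rw [← cancel_mono e.hom, zero_comp]
    obtain ⟨g, hg⟩ := (shiftFunctor T a).map_surjective (f ≫ e.hom)
    have : f ≫ e.hom = g⟦a⟧' := hg.symm
    rw [this, H g, Functor.map_zero]

lemma homVanishes_shift_iff {X Y : T} (a b q n : ℤ) (h : n + a = b + q) :
    HomVanishes (X⟦a⟧) (Y⟦b⟧) q ↔ HomVanishes X Y n := by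
  rw [homVanishes_shift_right_iff b q (b + q) rfl, homVanishes_shift_left_iff a (b + q) n h]

variable [HasZeroObject T] [Pretriangulated T]

section Exact

variable {D : Triangle T} (hD : D ∈ distTriang T)
include hD

lemma HomVanishes.obj₂ {W : T} {n : ℤ} (h₁ : HomVanishes W D.obj₁ n)
    (h₃ : HomVanishes W D.obj₃ n) : HomVanishes W D.obj₂ n := by
  intro f
  obtain ⟨g, hg⟩ := Triangle.coyoneda_exact₂ _ (Triangle.shift_distinguished D hD n) f (h₃ _)
  have hg₀ : g = 0 := h₁ g
  rw [hg, hg₀, zero_comp]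
  rfl

lemma HomVanishes.obj₃ {W : T} {n m : ℤ} (hnm : n + 1 = m) (h₂ : HomVanishes W D.obj₂ n)
    (h₁ : HomVanishes W D.obj₁ m) : HomVanishes W D.obj₃ n :=
  HomVanishes.obj₂ (rot_of_distTriang D hD) (D := D.rotate) h₂
    ((homVanishes_shift_right_iff 1 n m (by lia)).2 h₁)

lemma HomVanishes.obj₁ {W : T} {n m : ℤ} (hnm : m + 1 = n) (h₃ : HomVanishes W D.obj₃ m)
    (h₂ : HomVanishes W D.obj₂ n) : HomVanishes W D.obj₁ n :=
  HomVanishes.obj₂ (inv_rot_of_distTriang D hD) (D := D.invRotate)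
    ((homVanishes_shift_right_iff (-1) n m (by lia)).2 h₃) h₂

lemma HomVanishes.src₂ {Y : T} {n : ℤ} (h₁ : HomVanishes D.obj₁ Y n)
    (h₃ : HomVanishes D.obj₃ Y n) : HomVanishes D.obj₂ Y n := by
  intro f
  obtain ⟨g, hg⟩ := Triangle.yoneda_exact₂ D hD f (h₁ _)
  rw [hg, h₃ g, comp_zero]

lemma HomVanishes.src₃ {Y : T} {n m : ℤ} (hnm : m + 1 = n) (h₁ : HomVanishes D.obj₁ Y m)
    (h₂ : HomVanishes D.obj₂ Y n) : HomVanishes D.obj₃ Y n :=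
  HomVanishes.src₂ (rot_of_distTriang D hD) (D := D.rotate) h₂
    ((homVanishes_shift_left_iff 1 n m (by lia)).2 h₁)

lemma HomVanishes.src₁ {Y : T} {n m : ℤ} (hnm : n + 1 = m) (h₂ : HomVanishes D.obj₂ Y n)
    (h₃ : HomVanishes D.obj₃ Y m) : HomVanishes D.obj₁ Y n :=
  HomVanishes.src₂ (inv_rot_of_distTriang D hD) (D := D.invRotate)
    ((homVanishes_shift_left_iff (-1) n m (by lia)).2 h₃) h₂

end Exact

/-- In a pretriangulated category every retract is a direct summand. -/
lemma exists_biprod_of_retract {X Y : T} (h : Retract Y X) : ∃ Z : T, Nonempty (X ≅ Y ⊞ Z) := by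
  obtain ⟨Z, g, δ, hT⟩ := distinguished_cocone_triangle h.i
  have : IsSplitMono h.i := ⟨⟨h.splitMono⟩⟩
  obtain ⟨e, -, -⟩ := exists_iso_binaryBiproduct_of_distTriang _ hT
    (Triangle.mor₃_eq_zero_of_mono₁ _ hT (inferInstanceAs (Mono h.i)))
  exact ⟨Z, ⟨e⟩⟩

end HomVanishes

lemma IsIndSummand.retract {C : Type u} [Category.{v} C] [HasZeroMorphisms C]
    [HasBinaryBiproducts C] {Y X : C} (h : IsIndSummand Y X) : Nonempty (Retract Y X) := by
  obtain ⟨-, Z, ⟨e⟩⟩ := h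
  exact ⟨{ i := biprod.inl ≫ e.inv, r := e.hom ≫ biprod.fst }⟩

/-! ### Phases and Harder–Narasimhan filtrations -/

section Stability

variable {T : Type u} [Category.{v} T] [Preadditive T] [HasZeroObject T]
  [HasShift T ℤ] [∀ n : ℤ, (shiftFunctor T n).Additive] [Pretriangulated T]

section Triangle

variable {X Y Z : T} {f : X ⟶ Y} {g : Y ⟶ Z} {h : Z ⟶ X⟦(1 : ℤ)⟧}

lemma distinguished_of_iso₂ (hT : Triangle.mk f g h ∈ distTriang T) {Y' : T} (e : Y ≅ Y') :
    Triangle.mk (f ≫ e.hom) (e.inv ≫ g) h ∈ distTriang T := by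
  refine isomorphic_distinguished _ hT _
    (Triangle.isoMk _ _ (Iso.refl _) e.symm (Iso.refl _) ?_ ?_ ?_)
  exacts [show (f ≫ e.hom) ≫ e.inv = 𝟙 X ≫ f by simp, show (e.inv ≫ g) ≫ 𝟙 Z = e.inv ≫ g by simp,
    show h ≫ (𝟙 X)⟦1⟧' = 𝟙 Z ≫ h by simp]

lemma exists_lift_of_homVanishes (hT : Triangle.mk f g h ∈ distTriang T) {W : T}
    (hW : HomVanishes W Z 0) (φ : W ⟶ Y) : ∃ ψ : W ⟶ X, ψ ≫ f = φ := by
  obtain ⟨ψ, hψ⟩ := Triangle.coyoneda_exact₂ _ hT φ (homVanishes_zero_iff.1 hW _)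
  exact ⟨ψ, hψ.symm⟩

lemma eq_of_comp_mor₁_eq (hT : Triangle.mk f g h ∈ distTriang T) {W : T}
    (hW : HomVanishes W Z (-1)) {φ ψ : W ⟶ X} (e : φ ≫ f = ψ ≫ f) : φ = ψ := by
  rw [← sub_eq_zero]
  have e' : (φ - ψ) ≫ f = 0 := by simp [e]
  obtain ⟨χ, hχ⟩ := Triangle.coyoneda_exact₂ _ (inv_rot_of_distTriang _ hT) (φ - ψ) e'
  have hχ₀ : χ = 0 := hW χ
  rw [hχ, hχ₀, zero_comp]
  rfl

lemma exists_desc_of_homVanishes (hT : Triangle.mk f g h ∈ distTriang T) {W : T}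
    (hW : HomVanishes X W 0) (φ : Y ⟶ W) : ∃ ψ : Z ⟶ W, g ≫ ψ = φ := by
  obtain ⟨ψ, hψ⟩ := Triangle.yoneda_exact₂ _ hT φ (homVanishes_zero_iff.1 hW _)
  exact ⟨ψ, hψ.symm⟩

lemma eq_of_mor₂_comp_eq (hT : Triangle.mk f g h ∈ distTriang T) {W : T}
    (hW : HomVanishes X W (-1)) {φ ψ : Z ⟶ W} (e : g ≫ φ = g ≫ ψ) : φ = ψ := by
  rw [← sub_eq_zero]
  have e' : g ≫ (φ - ψ) = 0 := by simp [e]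
  obtain ⟨χ, hχ⟩ := Triangle.yoneda_exact₃ _ hT (φ - ψ) e'
  have hχ₀ : χ = 0 :=
    homVanishes_zero_iff.1 ((homVanishes_shift_left_iff 1 0 (-1) (by lia)).2 hW) χ
  rw [hχ, hχ₀, comp_zero]
  rfl

end Triangle

variable (σ : StabilityCondition T)

namespace StabilityCondition

lemma P_shift_int {s : ℝ} {X : T} (h : σ.P s X) (n : ℤ) : σ.P (s + n) (X⟦n⟧) := by
  induction n using Int.induction_on with
  | zero => simpa using σ.P_iso s ((shiftFunctorZero T ℤ).symm.app X) h
  | succ n ih =>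
    have := σ.P_iso _ ((shiftFunctorAdd' T (n : ℤ) 1 (n + 1) rfl).symm.app X)
      ((σ.P_shift _ _).2 ih)
    have e : s + ((n + 1 : ℤ) : ℝ) = s + (n : ℤ) + 1 := by push_cast; ring
    rw [e]
    exact this
  | pred n ih =>
    have := σ.P_iso _ ((shiftFunctorAdd' T (-(n : ℤ) - 1) 1 (-n) (by lia)).app X) ih
    have e : s + ((-n - 1 : ℤ) : ℝ) + 1 = s + (-n : ℤ) := by push_cast; ring
    rw [← σ.P_shift, e]
    exact this

end StabilityCondition

namespace ExtClosure

variable {σ}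

lemma mono {I J : Set ℝ} (hIJ : I ⊆ J) {X : T} (h : ExtClosure σ.P I X) :
    ExtClosure σ.P J X := by
  induction h with
  | of_mem hs hX => exact .of_mem (hIJ hs) hX
  | ext hD _ _ h₁ h₃ => exact .ext hD h₁ h₃

lemma of_iso {I : Set ℝ} {X : T} (h : ExtClosure σ.P I X) :
    ∀ {Y : T}, (X ≅ Y) → ExtClosure σ.P I Y := by
  induction h with
  | of_mem hs hX => exact fun e => .of_mem hs (σ.P_iso _ e hX)
  | @ext D hD h₁ h₃ _ _ =>
    intro Y e
    exact .ext (distinguished_of_iso₂ hD e) h₁ h₃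

lemma of_isZero {I : Set ℝ} (hI : I.Nonempty) {X : T} (hX : IsZero X) : ExtClosure σ.P I X :=
  .of_mem hI.some_mem (σ.P_zero _ hX)

lemma shift {I J : Set ℝ} (n : ℤ) (hIJ : ∀ a ∈ I, a + n ∈ J) {X : T}
    (h : ExtClosure σ.P I X) : ExtClosure σ.P J (X⟦n⟧) := by
  induction h with
  | of_mem hs hX => exact .of_mem (hIJ _ hs) (σ.P_shift_int hX n)
  | @ext D hD _ _ h₁ h₃ => exact .ext (Triangle.shift_distinguished D hD n) h₁ h₃

lemma homVanishes_zero {I J : Set ℝ} (hIJ : ∀ a ∈ I, ∀ b ∈ J, b < a) {X Y : T}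
    (hX : ExtClosure σ.P I X) (hY : ExtClosure σ.P J Y) : HomVanishes X Y 0 := by
  induction hX with
  | of_mem hs hX =>
    induction hY with
    | of_mem hs' hY => exact homVanishes_zero_iff.2 (σ.hom_eq_zero (hIJ _ hs _ hs') hX hY)
    | ext hD _ _ h₁ h₃ => exact HomVanishes.obj₂ hD h₁ h₃
  | ext hD _ _ h₁ h₃ => exact HomVanishes.src₂ hD h₁ h₃

lemma homVanishes {I J : Set ℝ} (n : ℤ) (hIJ : ∀ a ∈ I, ∀ b ∈ J, b + n < a) {X Y : T}
    (hX : ExtClosure σ.P I X) (hY : ExtClosure σ.P J Y) : HomVanishes X Y n := by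
  rw [← homVanishes_shift_right_iff n 0 n (add_zero n)]
  refine homVanishes_zero (J := (fun b => b + (n : ℝ)) '' J) ?_ hX
    (hY.shift n fun a ha => Set.mem_image_of_mem _ ha)
  rintro a ha c ⟨b, hb, rfl⟩
  exact hIJ a ha b hb

lemma singleton {s : ℝ} {X : T} (h : σ.P s X) : ExtClosure σ.P {s} X := .of_mem rfl h

end ExtClosure

namespace HNFiltration

variable {σ} {R : T} (F : HNFiltration σ.P R)

/-- The phase of the minimal Harder-Narasimhan factor. -/
def minPhase : ℝ := F.phase (Fin.last F.m)

lemma minFactor_mem : σ.P F.minPhase F.minFactor := F.factor_mem _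

lemma minFactor_nonzero : ¬ IsZero F.minFactor := F.factor_nonzero _

lemma extClosure_obj_castSucc (i : Fin (F.m + 1)) :
    ExtClosure σ.P (Set.Ioi (F.phase i)) (F.obj i.castSucc) := by
  induction i using Fin.induction with
  | zero => exact .of_isZero ⟨F.phase 0 + 1, by simp⟩ F.isZero_zero
  | succ i ih =>
    have hlt : F.phase i.succ < F.phase i.castSucc := F.phase_strictAnti i.castSucc_lt_succ
    rw [← Fin.succ_castSucc]
    exact .ext (F.distinguished i.castSucc)
      (ih.mono fun _ h => hlt.trans h) (.of_mem hlt (F.factor_mem _))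

lemma exists_last_triangle : ∃ (X : T) (x : X ⟶ R) (δ : F.minFactor ⟶ X⟦(1 : ℤ)⟧),
    Triangle.mk x F.toMinFactor δ ∈ distTriang T ∧ ExtClosure σ.P (Set.Ioi F.minPhase) X := by
  refine ⟨_, F.map (Fin.last F.m) ≫ F.topIso.hom, F.conn (Fin.last F.m), ?_,
    F.extClosure_obj_castSucc _⟩
  exact distinguished_of_iso₂ (F.distinguished (Fin.last F.m)) F.topIso

end HNFiltration

section LastTriangle

variable {σ} {t : ℝ} {X R M : T} {x : X ⟶ R} {m : R ⟶ M} {δ : M ⟶ X⟦(1 : ℤ)⟧}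

lemma ne_zero_of_last_triangle (hT : Triangle.mk x m δ ∈ distTriang T)
    (hX : ExtClosure σ.P (Set.Ioi t) X) (hM : σ.P t M) (hM₀ : ¬ IsZero M) : m ≠ 0 := by
  intro hm
  apply hM₀
  rw [IsZero.iff_id_eq_zero]
  -- If `m = 0`, then `𝟙 M` and `0` agree after `m`; Hom(X[1], M) = 0 by phases, so they are equal.
  refine eq_of_mor₂_comp_eq hT (ExtClosure.homVanishes (-1) ?_ hX (.singleton hM))
    (by rw [hm, zero_comp, zero_comp])
  rintro a (ha : t < a) _ rfl
  push_cast
  linarith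

lemma HNFiltration.toMinFactor_ne_zero (F : HNFiltration σ.P R) : F.toMinFactor ≠ 0 := by
  obtain ⟨X, x, δ, hT, hX⟩ := F.exists_last_triangle
  exact ne_zero_of_last_triangle hT hX F.minFactor_mem F.minFactor_nonzero

lemma HNFiltration.extClosure_Ici (F : HNFiltration σ.P R) :
    ExtClosure σ.P (Set.Ici F.minPhase) R := by
  obtain ⟨X, x, δ, hT, hX⟩ := F.exists_last_triangle
  exact .ext hT (hX.mono Set.Ioi_subset_Ici_self) (.of_mem Set.self_mem_Ici F.minFactor_mem)

/-- `F` shows that all phases of `R` are at least `F.minPhase`, so a smaller `G.minPhase` would kill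
the nonzero arrow `G.toMinFactor`. -/
lemma HNFiltration.minPhase_le (F G : HNFiltration σ.P R) : F.minPhase ≤ G.minPhase := by
  by_contra! h
  apply G.toMinFactor_ne_zero
  apply homVanishes_zero_iff.1 (ExtClosure.homVanishes_zero ?_ F.extClosure_Ici
    (.singleton G.minFactor_mem))
  rintro a (ha : F.minPhase ≤ a) _ rfl
  exact h.trans_le ha

lemma HNFiltration.minPhase_eq (F G : HNFiltration σ.P R) : F.minPhase = G.minPhase :=
  (F.minPhase_le G).antisymm (G.minPhase_le F)

/-- The minimal Harder-Narasimhan factor is unique up to isomorphism under `R`. -/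
lemma HNFiltration.exists_minFactor_iso (F G : HNFiltration σ.P R) :
    ∃ e : F.minFactor ≅ G.minFactor, F.toMinFactor ≫ e.hom = G.toMinFactor := by
  have key : ∀ F G : HNFiltration σ.P R, ∃ e : F.minFactor ⟶ G.minFactor,
      F.toMinFactor ≫ e = G.toMinFactor := by
    intro F G
    obtain ⟨X, x, δ, hT, hX⟩ := F.exists_last_triangle
    refine exists_desc_of_homVanishes hT (ExtClosure.homVanishes_zero ?_ hX
      (.singleton G.minFactor_mem)) G.toMinFactor
    rintro a (ha : _ < a) _ rfl
    rwa [G.minPhase_eq F]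
  have uniq : ∀ (F : HNFiltration σ.P R) (e : F.minFactor ⟶ F.minFactor),
      F.toMinFactor ≫ e = F.toMinFactor → e = 𝟙 _ := by
    intro F e he
    obtain ⟨X, x, δ, hT, hX⟩ := F.exists_last_triangle
    refine eq_of_mor₂_comp_eq hT (ExtClosure.homVanishes (-1) ?_ hX (.singleton F.minFactor_mem))
      (by rw [he, Category.comp_id])
    rintro a (ha : _ < a) _ rfl
    push_cast
    linarith
  obtain ⟨e, he⟩ := key F G
  obtain ⟨e', he'⟩ := key G F
  refine ⟨⟨e, e', uniq F _ ?_, uniq G _ ?_⟩, he⟩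
  · rw [reassoc_of% he, he']
  · rw [reassoc_of% he', he]

/-- `P(t)` is closed under retracts. -/
lemma StabilityCondition.P_of_retract {S V : T} (hV : σ.P t V) (r : Retract S V) : σ.P t S := by
  by_cases hS : IsZero S
  · exact σ.P_zero t hS
  obtain ⟨F⟩ := σ.exists_HN S hS
  obtain ⟨X, x, δ, hT, hX⟩ := F.exists_last_triangle
  -- The minimal phase of `S` is squeezed onto `t`, because V → S → σ_-(S) and S → V are both
  -- nonzero. Then the part `X` of `S` with phases above `t` maps to zero in `V`, hence in `S`, so
  -- it vanishes and S ≅ σ_-(S).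
  have h₁ : t ≤ F.minPhase := by
    by_contra! h
    apply F.toMinFactor_ne_zero
    have := σ.hom_eq_zero h hV F.minFactor_mem (r.r ≫ F.toMinFactor)
    rw [← cancel_epi r.r, this, comp_zero]
  have h₂ : F.minPhase ≤ t := by
    by_contra! h
    apply hS
    rw [IsZero.iff_id_eq_zero, ← r.retract]
    have : r.i = 0 := by
      refine homVanishes_zero_iff.1 (ExtClosure.homVanishes_zero ?_ F.extClosure_Ici
        (.singleton hV)) _
      rintro a (ha : _ ≤ a) _ rfl
      exact h.trans_le ha
    rw [this, zero_comp]
  obtain rfl := h₁.antisymm h₂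
  have hx : x = 0 := by
    rw [← cancel_mono r.i, zero_comp]
    refine homVanishes_zero_iff.1 (ExtClosure.homVanishes_zero ?_ hX (.singleton hV)) _
    rintro a (ha : _ < a) _ rfl
    exact ha
  have hX₀ : IsZero X := by
    rw [IsZero.iff_id_eq_zero]
    refine eq_of_comp_mor₁_eq hT (ExtClosure.homVanishes (-1) ?_ hX
      (.singleton F.minFactor_mem)) (by rw [hx, comp_zero, comp_zero])
    rintro a (ha : _ < a) _ rfl
    push_cast
    linarith
  have := (Triangle.isZero₁_iff_isIso₂ _ hT).1 hX₀
  have : IsIso F.toMinFactor := this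
  exact σ.P_iso _ (asIso F.toMinFactor).symm F.minFactor_mem

end LastTriangle

end Stability

/-! ### Truncation at a phase and the finite set of phases of an object -/

section Support

open scoped ZeroObject

variable {T : Type u} [Category.{v} T] [Preadditive T] [HasZeroObject T]
  [HasShift T ℤ] [∀ n : ℤ, (shiftFunctor T n).Additive] [Pretriangulated T]

/-- The triangle `Y → X → Z → Y[1]` truncates `X` at the phase `s`: the phases of `Y` are `≥ s` and
those of `Z` are `< s`. -/
structure IsTruncation (σ : StabilityCondition T) (s : ℝ) {X Y Z : T} (a : Y ⟶ X) (b : X ⟶ Z)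
    (c : Z ⟶ Y⟦(1 : ℤ)⟧) : Prop where
  distinguished : Triangle.mk a b c ∈ distTriang T
  ge : ExtClosure σ.P (Set.Ici s) Y
  lt : ExtClosure σ.P (Set.Iio s) Z

/-- The phases of the Harder-Narasimhan factors of `X`. -/
def phaseSupport (σ : StabilityCondition T) (X : T) : Set ℝ :=
  {s | ∃ (Y Z : T) (a : Y ⟶ X) (b : X ⟶ Z) (c : Z ⟶ Y⟦(1 : ℤ)⟧), IsTruncation σ s a b c ∧
    ∃ (Q : T) (_ : σ.P s Q) (f : Y ⟶ Q), f ≠ 0}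

variable {σ : StabilityCondition T} {s t : ℝ}

section IsTruncation

variable {X Y Z : T} {a : Y ⟶ X} {b : X ⟶ Z} {c : Z ⟶ Y⟦(1 : ℤ)⟧}

lemma IsTruncation.exists_lift (h : IsTruncation σ s a b c) {W : T}
    (hW : ExtClosure σ.P (Set.Ici s) W) (φ : W ⟶ X) : ∃ ψ : W ⟶ Y, ψ ≫ a = φ :=
  exists_lift_of_homVanishes h.distinguished
    (ExtClosure.homVanishes_zero (fun _ hx _ hy => lt_of_lt_of_le hy hx) hW h.lt) φ

lemma IsTruncation.hom_ext (h : IsTruncation σ s a b c) {W : T}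
    (hW : ExtClosure σ.P (Set.Ici s) W) {φ ψ : W ⟶ Y} (e : φ ≫ a = ψ ≫ a) : φ = ψ := by
  refine eq_of_comp_mor₁_eq h.distinguished (ExtClosure.homVanishes (-1) ?_ hW h.lt) e
  intro x (hx : s ≤ x) y (hy : y < s)
  push_cast
  linarith

lemma isTruncation_id (hX : ExtClosure σ.P (Set.Ici s) X) :
    IsTruncation σ s (𝟙 X) (0 : X ⟶ 0) 0 where
  distinguished := contractible_distinguished X
  ge := hX
  lt := .of_isZero ⟨s - 1, by simp⟩ (isZero_zero T)

end IsTruncation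

/-- If t < s, the truncated part of `X` also serves `R`, and the octahedral axiom presents the new
quotient as an extension of `M` by the old one. If t ≥ s, all of `R` already has phases ≥ s. -/
lemma exists_isTruncation_of_last_triangle [IsTriangulated T] {X R M : T} {x : X ⟶ R} {m : R ⟶ M}
    {δ : M ⟶ X⟦(1 : ℤ)⟧} (hT : Triangle.mk x m δ ∈ distTriang T)
    (hX : ExtClosure σ.P (Set.Ioi t) X) (hM : σ.P t M)
    (h : ∃ (Y Z : T) (a : Y ⟶ X) (b : X ⟶ Z) (c : Z ⟶ Y⟦(1 : ℤ)⟧), IsTruncation σ s a b c) :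
    ∃ (Y Z : T) (a : Y ⟶ R) (b : R ⟶ Z) (c : Z ⟶ Y⟦(1 : ℤ)⟧), IsTruncation σ s a b c := by
  obtain ⟨Y, Z, a, b, c, h⟩ := h
  by_cases hts : t < s
  · obtain ⟨Z', b', c', h'⟩ := distinguished_cocone_triangle (a ≫ x)
    have o := Triangulated.someOctahedron rfl h.distinguished hT h'
    exact ⟨Y, Z', _, b', c', h', h.ge, .ext o.mem h.lt (.of_mem hts hM)⟩
  · refine ⟨_, _, _, _, _, isTruncation_id (.ext hT (hX.mono fun y hy => ?_) (.of_mem ?_ hM))⟩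
    · exact (not_lt.1 hts).trans (le_of_lt hy)
    · exact not_lt.1 hts

lemma isTruncation_of_isZero {X : T} (hX : IsZero X) (s : ℝ) :
    IsTruncation σ s (𝟙 X) (0 : X ⟶ 0) 0 :=
  isTruncation_id (.of_isZero ⟨s, Set.self_mem_Ici⟩ hX)

variable (σ) in
lemma exists_isTruncation [IsTriangulated T] (s : ℝ) (X : T) :
    ∃ (Y Z : T) (a : Y ⟶ X) (b : X ⟶ Z) (c : Z ⟶ Y⟦(1 : ℤ)⟧), IsTruncation σ s a b c := by
  by_cases hX : IsZero X
  · exact ⟨_, _, _, _, _, isTruncation_of_isZero hX s⟩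
  obtain ⟨F⟩ := σ.exists_HN X hX
  have key (i : Fin (F.m + 2)) : ∃ (Y Z : T) (a : Y ⟶ F.obj i) (b : F.obj i ⟶ Z)
      (c : Z ⟶ Y⟦(1 : ℤ)⟧), IsTruncation σ s a b c := by
    induction i using Fin.induction with
    | zero => exact ⟨_, _, _, _, _, isTruncation_of_isZero F.isZero_zero s⟩
    | succ i ih =>
      exact exists_isTruncation_of_last_triangle (F.distinguished i)
        (F.extClosure_obj_castSucc i) (F.factor_mem i) ih
  obtain ⟨Y, Z, a, b, c, h⟩ := key (Fin.last F.m).succ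
  exact ⟨Y, Z, _, _, c, distinguished_of_iso₂ h.distinguished F.topIso, h.ge, h.lt⟩

/-- Maps from objects with phases ≥ s lift uniquely to the truncation, so truncating is functorial:
the part of `X` with phases ≥ s is a retract of that of `X'`, and a nonzero map to P(s) is carried
along. -/
lemma phaseSupport_subset_of_retract [IsTriangulated T] {X X' : T} (r : Retract X X') :
    phaseSupport σ X ⊆ phaseSupport σ X' := by
  rintro s ⟨Y, Z, a, b, c, h, Q, hQ, f, hf⟩
  obtain ⟨Y', Z', a', b', c', h'⟩ := exists_isTruncation σ s X'
  obtain ⟨i, hi⟩ := h'.exists_lift h.ge (a ≫ r.i)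
  obtain ⟨p, hp⟩ := h.exists_lift h'.ge (a' ≫ r.r)
  have hip : i ≫ p = 𝟙 Y := h.hom_ext h.ge (by
    rw [Category.assoc, hp, reassoc_of% hi, r.retract, Category.comp_id, Category.id_comp])
  refine ⟨Y', Z', a', b', c', h', Q, hQ, p ≫ f, fun e => hf ?_⟩
  rw [← Category.id_comp f, ← hip, Category.assoc, e, comp_zero]

/-- If the phases of `X` are all at least `s`, then `s` belongs to the support of `X` only if there
is a nonzero morphism from `X` to `P(s)`. -/
lemma exists_hom_ne_zero_of_mem_phaseSupport {X : T} (hX : ExtClosure σ.P (Set.Ici s) X)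
    (h : s ∈ phaseSupport σ X) : ∃ (Q : T) (_ : σ.P s Q) (f : X ⟶ Q), f ≠ 0 := by
  obtain ⟨Y, Z, a, b, c, h, Q, hQ, f, hf⟩ := h
  obtain ⟨i, hi⟩ := h.exists_lift hX (𝟙 X)
  have hai : a ≫ i = 𝟙 Y := h.hom_ext h.ge (by rw [Category.assoc, hi]; simp)
  refine ⟨Q, hQ, i ≫ f, fun e => hf ?_⟩
  rw [← Category.id_comp f, ← hai, Category.assoc, e, comp_zero]

lemma lt_of_mem_phaseSupport {X : T} (hX : ExtClosure σ.P (Set.Ioi t) X)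
    (h : s ∈ phaseSupport σ X) : t < s := by
  by_contra! hst
  obtain ⟨Q, hQ, f, hf⟩ := exists_hom_ne_zero_of_mem_phaseSupport
    (hX.mono fun y (hy : t < y) => hst.trans hy.le) h
  refine hf (homVanishes_zero_iff.1 (ExtClosure.homVanishes_zero ?_ hX (.singleton hQ)) f)
  rintro a (ha : t < a) _ rfl
  exact hst.trans_lt ha

lemma le_of_mem_phaseSupport {X : T} (hX : ExtClosure σ.P (Set.Ici t) X)
    (h : s ∈ phaseSupport σ X) : t ≤ s := by
  refine le_of_forall_lt fun r hr => ?_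
  exact lt_of_mem_phaseSupport (hX.mono fun y hy => hr.trans_le hy) h

section LastTriangle

variable {X R M : T} {x : X ⟶ R} {m : R ⟶ M} {δ : M ⟶ X⟦(1 : ℤ)⟧}
  (hT : Triangle.mk x m δ ∈ distTriang T) (hM : σ.P t M)
include hT hM

lemma exists_lift_of_ge (hst : t < s) {W : T} (hW : ExtClosure σ.P (Set.Ici s) W) (φ : W ⟶ R) :
    ∃ ψ : W ⟶ X, ψ ≫ x = φ := by
  refine exists_lift_of_homVanishes hT (ExtClosure.homVanishes_zero ?_ hW (.singleton hM)) φ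
  rintro a ha _ rfl
  exact hst.trans_le ha

lemma hom_ext_of_ge (hst : t < s) {W : T} (hW : ExtClosure σ.P (Set.Ici s) W) {φ ψ : W ⟶ X}
    (e : φ ≫ x = ψ ≫ x) : φ = ψ := by
  refine eq_of_comp_mor₁_eq hT (ExtClosure.homVanishes (-1) ?_ hW (.singleton hM)) e
  rintro a (ha : s ≤ a) _ rfl
  push_cast
  linarith

lemma mem_phaseSupport_of_last_triangle (hX : ExtClosure σ.P (Set.Ioi t) X)
    (hM₀ : ¬ IsZero M) : t ∈ phaseSupport σ R := by
  have hR : ExtClosure σ.P (Set.Ici t) R :=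
    .ext hT (hX.mono Set.Ioi_subset_Ici_self) (.of_mem Set.self_mem_Ici hM)
  exact ⟨R, 0, 𝟙 R, 0, 0, isTruncation_id hR, M, hM, m, ne_zero_of_last_triangle hT hX hM hM₀⟩

variable [IsTriangulated T]

/-- Truncation at s > t does not see `M`: objects with phases ≥ s map uniquely through `X` to `R`.
So each of the two truncations is a retract of any choice of the other. -/
lemma mem_phaseSupport_iff_of_lt (hst : t < s) :
    s ∈ phaseSupport σ R ↔ s ∈ phaseSupport σ X := by
  constructor
  · rintro ⟨Y, Z, a, b, c, h, Q, hQ, f, hf⟩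
    obtain ⟨Y', Z', a', b', c', h'⟩ := exists_isTruncation σ s X
    obtain ⟨i, hi⟩ := exists_lift_of_ge hT hM hst h.ge a
    obtain ⟨j, hj⟩ := h'.exists_lift h.ge i
    obtain ⟨p, hp⟩ := h.exists_lift h'.ge (a' ≫ x)
    have hjp : j ≫ p = 𝟙 Y := h.hom_ext h.ge (by
      rw [Category.assoc, hp, reassoc_of% hj, hi, Category.id_comp])
    refine ⟨Y', Z', a', b', c', h', Q, hQ, p ≫ f, fun e => hf ?_⟩
    rw [← Category.id_comp f, ← hjp, Category.assoc, e, comp_zero]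
  · rintro ⟨Y, Z, a, b, c, h, Q, hQ, f, hf⟩
    obtain ⟨Y', Z', a', b', c', h'⟩ := exists_isTruncation σ s R
    obtain ⟨j, hj⟩ := h'.exists_lift h.ge (a ≫ x)
    obtain ⟨i, hi⟩ := exists_lift_of_ge hT hM hst h'.ge a'
    obtain ⟨p, hp⟩ := h.exists_lift h'.ge i
    have hjp : j ≫ p = 𝟙 Y := h.hom_ext h.ge (hom_ext_of_ge hT hM hst h.ge (by
      simp only [Category.assoc, Category.id_comp]
      rw [reassoc_of% hp, hi, hj]))
    refine ⟨Y', Z', a', b', c', h', Q, hQ, p ≫ f, fun e => hf ?_⟩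
    rw [← Category.id_comp f, ← hjp, Category.assoc, e, comp_zero]

variable (hX : ExtClosure σ.P (Set.Ioi t) X)
include hX

lemma phaseSupport_subset_insert : phaseSupport σ R ⊆ insert t (phaseSupport σ X) := by
  intro s hs
  have hR : ExtClosure σ.P (Set.Ici t) R :=
    .ext hT (hX.mono Set.Ioi_subset_Ici_self) (.of_mem Set.self_mem_Ici hM)
  obtain h | rfl := (le_of_mem_phaseSupport hR hs).lt_or_eq
  · exact Or.inr ((mem_phaseSupport_iff_of_lt hT hM h).1 hs)
  · exact Or.inl rfl

lemma phaseSupport_subset_of_last_triangle : phaseSupport σ X ⊆ phaseSupport σ R :=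
  fun _ hs => (mem_phaseSupport_iff_of_lt hT hM (lt_of_mem_phaseSupport hX hs)).2 hs

end LastTriangle

lemma phaseSupport_eq_empty_of_isZero {X : T} (hX : IsZero X) : phaseSupport σ X = ∅ := by
  ext s
  simp only [Set.mem_empty_iff_false, iff_false]
  exact fun h => lt_irrefl s
    (lt_of_mem_phaseSupport (.of_isZero ⟨s + 1, by simp⟩ hX) h)

lemma finite_phaseSupport [IsTriangulated T] (X : T) : (phaseSupport σ X).Finite := by
  by_cases hX : IsZero X
  · simp [phaseSupport_eq_empty_of_isZero hX]
  obtain ⟨F⟩ := σ.exists_HN X hX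
  have key (i : Fin (F.m + 2)) : (phaseSupport σ (F.obj i)).Finite := by
    induction i using Fin.induction with
    | zero => simp [phaseSupport_eq_empty_of_isZero F.isZero_zero]
    | succ i ih =>
      exact (ih.insert _).subset (phaseSupport_subset_insert (F.distinguished i)
        (F.factor_mem i) (F.extClosure_obj_castSucc i))
  exact (key (Fin.last F.m).succ).subset
    (phaseSupport_subset_of_retract (.ofIso F.topIso.symm))

end Support

/-! ### Split idempotents and indecomposable objects -/

section Idempotents

variable {C : Type u} [Category.{v} C] [IsIdempotentComplete C]

lemma exists_retract_of_idem {X : C} (e : X ⟶ X) (he : e ≫ e = e) :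
    ∃ (Y : C) (r : Retract Y X), r.r ≫ r.i = e := by
  obtain ⟨Y, i, p, h₁, h₂⟩ := IsIdempotentComplete.idempotents_split X e he
  exact ⟨Y, ⟨i, p, h₁⟩, h₂⟩

variable {D : Type*} [Category* D] (F : C ⥤ D) [F.Full] [F.Faithful]

/-- An idempotent which factors through an object in the image of a fully faithful functor from
an idempotent complete category is split. -/
lemma exists_retract_of_idem_factor {E : D} {X : C} (a : E ⟶ F.obj X)
    (b : F.obj X ⟶ E) (h : (a ≫ b) ≫ a ≫ b = a ≫ b) :
    ∃ (K : C) (r : Retract (F.obj K) E), r.r ≫ r.i = a ≫ b := by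
  simp only [Category.assoc] at h
  obtain ⟨g, hg⟩ := F.map_surjective (b ≫ a)
  -- `g`, the preimage of `b ≫ a`, need not be idempotent, but `g³ = g²`, so its square is; the
  -- summand of `X` is cut out by the square.
  have hg₃ : g ≫ g ≫ g = g ≫ g := by
    apply F.map_injective
    simp only [F.map_comp, hg, Category.assoc]
    rw [reassoc_of% h]
  obtain ⟨K, r, hr⟩ := exists_retract_of_idem (g ≫ g) (by
    rw [Category.assoc, hg₃, hg₃])
  have hi : r.i ≫ g ≫ g = r.i := by rw [← hr, reassoc_of% r.retract]
  have hig : r.i ≫ g = r.i := by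
    rw [← hi]
    simp only [Category.assoc]
    rw [hg₃]
  refine ⟨K, ⟨F.map r.i ≫ b, a ≫ F.map r.r, ?_⟩, ?_⟩
  · have : F.map r.i ≫ b ≫ a ≫ F.map r.r = F.map (r.i ≫ g ≫ r.r) := by
      simp [hg]
    rw [Category.assoc, this, reassoc_of% hig, r.retract, F.map_id]
  · have : F.map r.r ≫ F.map r.i = b ≫ a ≫ b ≫ a := by
      rw [← F.map_comp, hr, F.map_comp, hg, Category.assoc]
    simp only [Category.assoc]
    rw [reassoc_of% this, h, h]

lemma exists_iso_of_retract_obj {E : D} {X : C}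
    (r : Retract E (F.obj X)) : ∃ K : C, Nonempty (E ≅ F.obj K) := by
  obtain ⟨K, s, hs⟩ := exists_retract_of_idem_factor F r.i r.r (by simp)
  exact ⟨K, ⟨⟨s.r, s.i, by rw [hs, r.retract], s.retract⟩⟩⟩

end Idempotents

section Additive

variable {C : Type u} [Category.{v} C] [Preadditive C]

/-- A decomposition of the identity of `X` as a sum of two split idempotents. -/
lemma nonempty_iso_biprod [HasBinaryBiproducts C] {X Y Z : C} (r : Retract Y X) (r' : Retract Z X)
    (h : r.r ≫ r.i + r'.r ≫ r'.i = 𝟙 X) : Nonempty (X ≅ Y ⊞ Z) := by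
  have h₁ : r.i ≫ r'.r = 0 := by
    have : r.i ≫ (r.r ≫ r.i + r'.r ≫ r'.i) ≫ r'.r = r.i ≫ r'.r := by rw [h, Category.id_comp]
    simpa using this
  have h₂ : r'.i ≫ r.r = 0 := by
    have : r'.i ≫ (r.r ≫ r.i + r'.r ≫ r'.i) ≫ r.r = r'.i ≫ r.r := by rw [h, Category.id_comp]
    simpa using this
  let b : BinaryBicone Y Z :=
    { pt := X, fst := r.r, snd := r'.r, inl := r.i, inr := r'.i, inl_fst := r.retract,
      inl_snd := h₁, inr_fst := h₂, inr_snd := r'.retract }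
  exact ⟨biprod.uniqueUpToIso _ _ (isBinaryBilimitOfTotal b h)⟩

lemma eq_zero_or_eq_id_of_indecomposable [HasBinaryBiproducts C] [IsIdempotentComplete C] {X : C}
    (hX : Indecomposable X) (e : X ⟶ X) (he : e ≫ e = e) : e = 0 ∨ e = 𝟙 X := by
  obtain ⟨Y, r, hr⟩ := exists_retract_of_idem e he
  obtain ⟨Z, r', hr'⟩ := exists_retract_of_idem (𝟙 X - e) (by simp [he])
  obtain ⟨φ⟩ := nonempty_iso_biprod r r' (by rw [hr, hr', add_sub_cancel])
  obtain h | h := hX.2 _ _ φ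
  · left
    rw [← hr, h.eq_of_tgt r.r 0, zero_comp]
  · right
    rw [h.eq_of_tgt r'.r 0, zero_comp] at hr'
    exact (sub_eq_zero.1 hr'.symm).symm

lemma indecomposable_of_idem [HasBinaryBiproducts C] {X : C} (hX : ¬ IsZero X)
    (h : ∀ e : X ⟶ X, e ≫ e = e → e = 0 ∨ e = 𝟙 X) : Indecomposable X := by
  refine ⟨hX, fun Y Z φ => ?_⟩
  obtain h | h := h (φ.hom ≫ biprod.fst ≫ biprod.inl ≫ φ.inv) (by simp)
  · left
    rw [IsZero.iff_id_eq_zero]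
    have : (biprod.inl ≫ φ.inv) ≫ (φ.hom ≫ biprod.fst ≫ biprod.inl ≫ φ.inv) ≫
      φ.hom ≫ biprod.fst = 𝟙 Y := by simp
    rw [← this, h, zero_comp, comp_zero]
  · right
    rw [IsZero.iff_id_eq_zero]
    have : (biprod.inr ≫ φ.inv) ≫ (φ.hom ≫ biprod.fst ≫ biprod.inl ≫ φ.inv) ≫
      φ.hom ≫ biprod.snd = 0 := by simp
    rw [← this, h]
    simp

lemma isIndSummand_of_retract [HasBinaryBiproducts C] [IsIdempotentComplete C] {X Y : C}
    (hY : Indecomposable Y) (r : Retract Y X) : IsIndSummand Y X := by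
  obtain ⟨Z, r', hr'⟩ := exists_retract_of_idem (𝟙 X - r.r ≫ r.i) (by simp)
  exact ⟨hY, Z, nonempty_iso_biprod r r' (by rw [hr', add_sub_cancel])⟩

variable {D : Type*} [Category* D] [Preadditive D] (F : C ⥤ D) [F.Full] [F.Faithful]

lemma indecomposable_obj [F.Additive] [HasBinaryBiproducts C] [IsIdempotentComplete C]
    [HasBinaryBiproducts D] {X : C} (hX : Indecomposable X) : Indecomposable (F.obj X) := by
  refine indecomposable_of_idem ?_ fun e he => ?_
  · intro h
    apply hX.1
    rw [IsZero.iff_id_eq_zero]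
    apply F.map_injective
    rw [F.map_id, h.eq_of_src (𝟙 _) 0, F.map_zero]
  · obtain ⟨e, rfl⟩ := F.map_surjective e
    rw [← F.map_comp] at he
    obtain rfl | rfl := eq_zero_or_eq_id_of_indecomposable hX e (F.map_injective he)
    · exact Or.inl (F.map_zero _ _)
    · exact Or.inr (F.map_id X)

end Additive

section Biproduct

variable {C : Type u} [Category.{v} C] {D : Type*} [Category* D] [Preadditive D] (F : C ⥤ D)
  [F.Full] [F.Faithful]

/-- The components of `𝟙 E` through the two summands add up to the identity, and their product in
one order passes through a map F(X) → G(Y), hence is zero. This alone makes both idempotent. They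
split through the images of `F` and `G`, and indecomposability removes one of them. -/
lemma exists_iso_of_retract_biprod [IsIdempotentComplete C] [HasBinaryBiproducts D]
    (G : C ⥤ D) [G.Full] [G.Faithful] {E : D} (hE : Indecomposable E) {X Y : C}
    (hXY : ∀ f : F.obj X ⟶ G.obj Y, f = 0) (r : Retract E (F.obj X ⊞ G.obj Y)) :
    (∃ K : C, Nonempty (E ≅ F.obj K)) ∨ ∃ K : C, Nonempty (E ≅ G.obj K) := by
  let a₁ := r.i ≫ biprod.fst
  let b₁ := biprod.inl ≫ r.r
  let a₂ := r.i ≫ biprod.snd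
  let b₂ := biprod.inr ≫ r.r
  have htot : a₁ ≫ b₁ + a₂ ≫ b₂ = 𝟙 E := by
    have : r.i ≫ (biprod.fst ≫ biprod.inl + biprod.snd ≫ biprod.inr) ≫ r.r = 𝟙 E := by
      rw [biprod.total, Category.id_comp, r.retract]
    rw [← this]
    simp only [a₁, a₂, b₁, b₂, Preadditive.add_comp, Preadditive.comp_add, Category.assoc]
  have h₀ : b₁ ≫ a₂ = 0 := hXY _
  have h₁₂ : (a₁ ≫ b₁) ≫ a₂ ≫ b₂ = 0 := by simp [reassoc_of% h₀]
  have h₁ : (a₁ ≫ b₁) ≫ a₁ ≫ b₁ = a₁ ≫ b₁ := by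
    have : (a₁ ≫ b₁) ≫ (a₁ ≫ b₁ + a₂ ≫ b₂) = a₁ ≫ b₁ := by rw [htot, Category.comp_id]
    rwa [Preadditive.comp_add, h₁₂, add_zero] at this
  have h₂ : (a₂ ≫ b₂) ≫ a₂ ≫ b₂ = a₂ ≫ b₂ := by
    have : (a₁ ≫ b₁ + a₂ ≫ b₂) ≫ a₂ ≫ b₂ = a₂ ≫ b₂ := by rw [htot, Category.id_comp]
    rwa [Preadditive.add_comp, h₁₂, zero_add] at this
  obtain ⟨K₁, r₁, hr₁⟩ := exists_retract_of_idem_factor F a₁ b₁ h₁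
  obtain ⟨K₂, r₂, hr₂⟩ := exists_retract_of_idem_factor G a₂ b₂ h₂
  rw [← hr₁, ← hr₂] at htot
  obtain ⟨φ⟩ := nonempty_iso_biprod r₁ r₂ htot
  obtain h | h := hE.2 _ _ φ
  · right
    rw [h.eq_of_tgt r₁.r 0, zero_comp, zero_add] at htot
    exact ⟨K₂, ⟨⟨r₂.r, r₂.i, htot, r₂.retract⟩⟩⟩
  · left
    rw [h.eq_of_tgt r₂.r 0, zero_comp, add_zero] at htot
    exact ⟨K₁, ⟨⟨r₁.r, r₁.i, htot, r₁.retract⟩⟩⟩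

end Biproduct

/-! ### Local endomorphism rings and indecomposable summands in Hom-finite categories -/

section Algebra

open Polynomial

/-- A finite-dimensional algebra without nontrivial idempotents is local. -/
lemma isUnit_or_isUnit_one_sub_of_idem {k R : Type*} [Field k] [Ring R] [Algebra k R]
    [Module.Finite k R] (h : ∀ e : R, e * e = e → e = 0 ∨ e = 1) (x : R) :
    IsUnit x ∨ IsUnit (1 - x) := by
  obtain ⟨q, hp, hq⟩ := exists_eq_pow_rootMultiplicity_mul_and_not_dvd (minpoly k x)
    (minpoly.ne_zero (Algebra.IsIntegral.isIntegral x)) 0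
  generalize (minpoly k x).rootMultiplicity 0 = n at hp
  rw [C_0, sub_zero] at hp hq
  -- The minimal polynomial is `X ^ n * q` with `q(0) ≠ 0`. Bézout gives complementary idempotents;
  -- the exponent `n + 1` rather than `n` ensures a factor `x` even for `n = 0`. If the first
  -- idempotent is `0`, `x` is nilpotent; if it is `1`, `x` is a unit.
  obtain ⟨u, v, huv⟩ : IsCoprime (X ^ (n + 1)) q :=
    ((irreducible_X.coprime_iff_not_dvd).2 hq).pow_left
  have hpx : aeval x (X ^ (n + 1) * q) = 0 := by
    rw [pow_succ', mul_assoc, ← hp, map_mul, minpoly.aeval, mul_zero]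
  have hsum : aeval x (u * X ^ (n + 1)) + aeval x (v * q) = 1 := by
    rw [← map_add, huv, map_one]
  have hmul : aeval x (u * X ^ (n + 1)) * aeval x (v * q) = 0 := by
    rw [← map_mul, show u * X ^ (n + 1) * (v * q) = u * v * (X ^ (n + 1) * q) by ring, map_mul,
      hpx, mul_zero]
  obtain h₀ | h₁ := h (aeval x (u * X ^ (n + 1))) (by
    rw [← add_zero (_ * _), ← hmul, ← mul_add, hsum, mul_one])
  · right
    rw [h₀, zero_add] at hsum
    refine IsNilpotent.isUnit_one_sub ⟨n + 1, ?_⟩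
    have : aeval x (v * (X ^ (n + 1) * q)) = 0 := by rw [map_mul, hpx, mul_zero]
    rwa [show v * (X ^ (n + 1) * q) = X ^ (n + 1) * (v * q) by ring, map_mul, hsum, mul_one,
      map_pow, aeval_X] at this
  · left
    have e₁ : aeval x (u * X ^ n) * x = 1 := by
      rw [← h₁, pow_succ, ← mul_assoc u, map_mul _ _ X, aeval_X]
    have e₂ : x * aeval x (u * X ^ n) = 1 := by
      rw [← h₁, pow_succ, ← mul_assoc u, mul_comm _ X, map_mul _ X, aeval_X]
    exact ⟨⟨x, _, e₂, e₁⟩, rfl⟩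

end Algebra

section HomFinite

variable (k : Type t) [Field k] {A : Type u} [Category.{v} A] [Abelian A] [Linear k A]
  (hfin : ∀ X Y : A, Module.Finite k (X ⟶ Y))

include k hfin

/-- Composition with a mono is injective on the finite-dimensional space End(X), hence surjective,
so the identity is hit and `f` splits. -/
lemma isIso_of_mono_endo {X : A} (f : X ⟶ X) [Mono f] : IsIso f := by
  have := hfin X X
  have hinj : Function.Injective (Linear.rightComp k X f) := fun g h e => by
    rwa [← cancel_mono f]
  obtain ⟨g, hg⟩ := LinearMap.surjective_of_injective hinj (𝟙 X)
  have : IsSplitEpi f := ⟨⟨g, hg⟩⟩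
  exact isIso_of_mono_of_isSplitEpi f

lemma isIso_of_epi_endo {X : A} (f : X ⟶ X) [Epi f] : IsIso f := by
  have := hfin X X
  have hinj : Function.Injective (Linear.leftComp k X f) := fun g h e => by
    rwa [← cancel_epi f]
  obtain ⟨g, hg⟩ := LinearMap.surjective_of_injective hinj (𝟙 X)
  have : IsSplitMono f := ⟨⟨g, hg⟩⟩
  exact isIso_of_epi_of_isSplitMono f

/-- The endomorphism ring of an indecomposable object of a Hom-finite abelian category is local. -/
lemma isIso_or_isIso_id_sub {X : A} (hX : Indecomposable X) (f : X ⟶ X) :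
    IsIso f ∨ IsIso (𝟙 X - f) := by
  have : Module.Finite k (End X) := hfin X X
  obtain h | h := isUnit_or_isUnit_one_sub_of_idem (k := k) (R := End X)
    (eq_zero_or_eq_id_of_indecomposable hX) f
  · exact Or.inl ((isUnit_iff_isIso f).1 h)
  · exact Or.inr ((isUnit_iff_isIso (𝟙 X - f)).1 h)

/-- `f ↦ r.r ≫ f ≫ r.i` embeds End(Y) in End(X) and misses the identity. This is the measure for
decomposing objects into indecomposables in `of_indSummands`. -/
lemma finrank_end_lt_of_retract {X Y : A} (r : Retract Y X) (h : r.r ≫ r.i ≠ 𝟙 X) :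
    Module.finrank k (Y ⟶ Y) < Module.finrank k (X ⟶ X) := by
  have := hfin X X
  let φ := Linear.rightComp k X r.i ∘ₗ Linear.leftComp k Y r.r
  have hφ : Function.Injective φ := by
    intro f g e
    simp only [φ, LinearMap.comp_apply, Linear.leftComp_apply, Linear.rightComp_apply,
      cancel_mono, cancel_epi] at e
    exact e
  rw [← LinearMap.finrank_range_of_inj hφ]
  refine Submodule.finrank_lt fun htop => h ?_
  obtain ⟨f, hf⟩ := LinearMap.range_eq_top.1 htop (𝟙 X)
  simp only [φ, LinearMap.comp_apply, Linear.leftComp_apply, Linear.rightComp_apply] at hf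
  have : r.r ≫ r.i = (r.r ≫ r.i) ≫ (r.r ≫ f) ≫ r.i := by rw [hf, Category.comp_id]
  rw [this, ← hf]
  simp only [Category.assoc]
  rw [reassoc_of% r.retract]

/-- A property which is closed under finite direct sums and holds for all indecomposable summands
of an object of a Hom-finite abelian category holds for that object. -/
lemma of_indSummands {Q : A → Prop} (h₀ : ∀ X, IsZero X → Q X)
    (hQ : ∀ X Y Z : A, (X ≅ Y ⊞ Z) → Q Y → Q Z → Q X) (X : A)
    (hX : ∀ Γ, IsIndSummand Γ X → Q Γ) : Q X := by
  have := hfin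
  induction hn : Module.finrank k (X ⟶ X) using Nat.strong_induction_on generalizing X with
  | _ n ih =>
    by_cases hX₀ : IsZero X
    · exact h₀ X hX₀
    by_cases hX₁ : Indecomposable X
    · exact hX X (isIndSummand_of_retract hX₁ (.refl X))
    simp only [Indecomposable, hX₀, not_false_iff, true_and, not_forall, not_or] at hX₁
    obtain ⟨Y, Z, φ, hY, hZ⟩ := hX₁
    let rY : Retract Y X := { i := biprod.inl ≫ φ.inv, r := φ.hom ≫ biprod.fst }
    let rZ : Retract Z X := { i := biprod.inr ≫ φ.inv, r := φ.hom ≫ biprod.snd }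
    have hYZ : rY.i ≫ rZ.r = 0 := by simp [rY, rZ]
    have hZY : rZ.i ≫ rY.r = 0 := by simp [rY, rZ]
    have hlt {Y Z : A} (hZ : ¬ IsZero Z) (rY : Retract Y X) (rZ : Retract Z X)
        (h : rY.i ≫ rZ.r = 0) : Module.finrank k (Y ⟶ Y) < n := by
      rw [← hn]
      refine finrank_end_lt_of_retract k hfin rY fun e => hZ ?_
      rw [IsZero.iff_id_eq_zero, ← rZ.retract, ← Category.id_comp rZ.r, ← e, Category.assoc, h,
        comp_zero, comp_zero]
    have hsub {Y : A} (rY : Retract Y X) (Γ : A) (hΓ : IsIndSummand Γ Y) : Q Γ := by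
      obtain ⟨r⟩ := hΓ.retract
      exact hX Γ (isIndSummand_of_retract hΓ.1 (r.trans rY))
    exact hQ X Y Z φ (ih _ (hlt hZ rY rZ hYZ) Y (hsub rY) rfl)
      (ih _ (hlt hY rZ rY hZY) Z (hsub rZ) rfl)

lemma exists_isIndSummand {X : A} (hX : ¬ IsZero X) : ∃ Γ, IsIndSummand Γ X := by
  by_contra! h
  refine hX (of_indSummands k hfin (Q := fun X => IsZero X) (fun _ => id) ?_ X
    fun Γ hΓ => (h Γ hΓ).elim)
  intro X Y Z φ hY hZ
  exact ((biprod_isZero_iff Y Z).2 ⟨hY, hZ⟩).of_iso φ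

end HomFinite

/-! ### The embedding of A in its bounded derived category -/

section Derived

variable (k : Type t) [Field k] {A : Type u} [Category.{v} A] [Abelian A]
  [HasDerivedCategory.{w} A]

open DerivedCategory

variable (A) in
/-- The embedding `A → D^b(A)` is the restriction of the embedding in the derived category. -/
def singleCompιIso : single A ⋙ Bounded.ι ≅ singleFunctor A 0 :=
  ObjectProperty.liftCompιIso _ _ _

instance : (single A).Full :=
  have : (single A ⋙ Bounded.ι).Full := Functor.Full.of_iso (singleCompιIso A).symm
  Functor.Full.of_comp_faithful (single A) Bounded.ι

instance : (single A).Faithful :=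
  have : (single A ⋙ Bounded.ι).Faithful := Functor.Faithful.of_iso (singleCompιIso A).symm
  Functor.Faithful.of_comp (single A) Bounded.ι

instance : (single A).Additive :=
  have : (single A ⋙ Bounded.ι).Additive := Functor.additive_of_iso (singleCompιIso A).symm
  Functor.additive_of_comp_faithful (single A) Bounded.ι

section Linear

variable [Linear k A]

instance : Functor.Linear k (single A) where
  map_smul f r := by
    apply Bounded.ι.map_injective
    have : Functor.Linear k (single A ⋙ Bounded.ι) :=
      Functor.linear_of_iso k (singleCompιIso A).symm
    exact (Functor.map_smul (single A ⋙ Bounded.ι) r f).trans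
      (Functor.map_smul Bounded.ι r ((single A).map f)).symm

instance (n : ℤ) : Functor.Linear k (shiftFunctor (Db A) n) where
  map_smul f r := by
    apply Bounded.ι.map_injective
    have : Functor.Linear k (shiftFunctor (Db A) n ⋙ Bounded.ι) :=
      Functor.linear_of_iso k (Bounded.ι.commShiftIso n).symm
    exact (Functor.map_smul (shiftFunctor (Db A) n ⋙ Bounded.ι) r f).trans
      (Functor.map_smul Bounded.ι r (f⟦n⟧')).symm

end Linear

/-- For the canonical t-structure the source is in degrees ≤ 0 and the target, shifted by `n < 0`,
is in degrees ≥ -n > 0. -/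
lemma homVanishes_single_of_neg (X Y : A) {n : ℤ} (hn : n < 0) :
    HomVanishes ((single A).obj X) ((single A).obj Y) n := by
  intro f
  apply Bounded.ι.map_injective
  rw [Functor.map_zero, ← cancel_mono ((Bounded.ι.commShiftIso n).hom.app _), zero_comp]
  have h₁ : TStructure.t.IsLE (Bounded.ι.obj ((single A).obj X)) 0 :=
    TStructure.t.isLE_of_iso ((singleCompιIso A).symm.app X) 0
  have h₂ : TStructure.t.IsGE (Bounded.ι.obj ((single A).obj Y)) 0 :=
    TStructure.t.isGE_of_iso ((singleCompιIso A).symm.app Y) 0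
  have h₃ := TStructure.t.isGE_shift (Bounded.ι.obj ((single A).obj Y)) 0 n (-n)
  exact TStructure.t.zero_of_isLE_of_isGE _ 0 (-n) (by lia) h₁ h₃

/-- A short exact sequence in `A` gives a distinguished triangle in `D^b(A)`. -/
lemma exists_distinguished_of_shortExact {S : ShortComplex A} (hS : S.ShortExact) :
    ∃ δ : (single A).obj S.X₃ ⟶ ((single A).obj S.X₁)⟦(1 : ℤ)⟧,
      Triangle.mk ((single A).map S.f) ((single A).map S.g) δ ∈ distTriang (Db A) := by
  obtain ⟨δ, hδ⟩ := Bounded.ι.map_surjective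
    ((singleCompιIso A).hom.app S.X₃ ≫ hS.singleδ ≫ ((singleCompιIso A).inv.app S.X₁)⟦(1 : ℤ)⟧' ≫
      (Bounded.ι.commShiftIso (1 : ℤ)).inv.app ((single A).obj S.X₁))
  refine ⟨δ, (Bounded.ι.map_distinguished_iff _).1 ?_⟩
  refine isomorphic_distinguished _ hS.singleTriangle_distinguished _
    (Triangle.isoMk _ _ ((singleCompιIso A).app S.X₁) ((singleCompιIso A).app S.X₂)
      ((singleCompιIso A).app S.X₃) ((singleCompιIso A).hom.naturality S.f)
      ((singleCompιIso A).hom.naturality S.g) ?_)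
  change (Bounded.ι.map δ ≫ (Bounded.ι.commShiftIso (1 : ℤ)).hom.app ((single A).obj S.X₁)) ≫
    ((singleCompιIso A).hom.app S.X₁)⟦(1 : ℤ)⟧' = (singleCompιIso A).hom.app S.X₃ ≫ hS.singleδ
  rw [hδ]
  simp [← Functor.map_comp]

/-- The essential image of `A` in `D^b(A)` is closed under extensions. -/
lemma exists_iso_single_of_distinguished {D : Triangle (Db A)} (hD : D ∈ distTriang (Db A))
    {X Y : A} (eX : D.obj₁ ≅ (single A).obj X) (eY : D.obj₃ ≅ (single A).obj Y) :
    ∃ M : A, Nonempty (D.obj₂ ≅ (single A).obj M) := by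
  have hT' := Bounded.ι.map_distinguished _ hD
  have h {Z : Db A} {X : A} (e : Z ≅ (single A).obj X) :
      TStructure.t.IsLE (Bounded.ι.obj Z) 0 ∧ TStructure.t.IsGE (Bounded.ι.obj Z) 0 :=
    ⟨TStructure.t.isLE_of_iso ((Bounded.ι.mapIso e ≪≫ (singleCompιIso A).app X).symm) 0,
      TStructure.t.isGE_of_iso ((Bounded.ι.mapIso e ≪≫ (singleCompιIso A).app X).symm) 0⟩
  have hle : (Bounded.ι.obj D.obj₂).IsLE 0 := TStructure.t.isLE₂ _ hT' 0 (h eX).1 (h eY).1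
  have hge : (Bounded.ι.obj D.obj₂).IsGE 0 := TStructure.t.isGE₂ _ hT' 0 (h eX).2 (h eY).2
  obtain ⟨M, ⟨e⟩⟩ := exists_iso_singleFunctor_obj_of_isGE_of_isLE (Bounded.ι.obj D.obj₂) 0
  exact ⟨M, ⟨Bounded.ι.preimageIso (e ≪≫ (singleCompιIso A).symm.app M)⟩⟩

end Derived

/-! ### The Happel–Ringel argument -/

section Exceptional

variable {k : Type t} [Field k] {A : Type u} [Category.{v} A] [Abelian A]

lemma shortExact_kernel_of_epi {X Y : A} (π : X ⟶ Y) [Epi π] :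
    (ShortComplex.mk (kernel.ι π) π (kernel.condition π)).ShortExact where
  exact := ShortComplex.exact_kernel π

lemma shortExact_cokernel_of_mono {X Y : A} (ι : X ⟶ Y) [Mono ι] :
    (ShortComplex.mk ι (cokernel.π ι) (cokernel.condition ι)).ShortExact where
  exact := ShortComplex.exact_cokernel ι

variable [HasDerivedCategory.{w} A] [Linear k A] (hfin : ∀ X Y : A, Module.Finite k (X ⟶ Y)) (hher : IsHereditary A)

include hfin hher

/-- A nonzero endomorphism of an indecomposable object without self-extensions is invertible. -/
lemma isIso_endo_of_homVanishes {Γ : A} (hΓ : Indecomposable Γ)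
    (hext : HomVanishes ((single A).obj Γ) ((single A).obj Γ) 1) (f : Γ ⟶ Γ) (hf : f ≠ 0) :
    IsIso f := by
  let π := factorThruImage f
  let ι := image.ι f
  have hfac : π ≫ ι = f := image.fac f
  let q := cokernel.π ι
  obtain ⟨ε, hε⟩ := exists_distinguished_of_shortExact (shortExact_kernel_of_epi π)
  obtain ⟨δ, hδ⟩ := exists_distinguished_of_shortExact (shortExact_cokernel_of_mono ι)
  dsimp only at ε δ hε hδ
  -- Here `f` is factored as Γ → I → Γ through its image, with kernel K, cokernel C, and extension
  -- class `δ : C → I[1]`. The obstruction to lifting `δ` along `π` lies in Ext²(C, K) = 0.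
  have hδε : δ ≫ ε⟦(1 : ℤ)⟧' = 0 :=
    (homVanishes_shift_right_iff 1 1 2 rfl).2 (hher _ _ 2 le_rfl) _
  obtain ⟨δ', hδ'⟩ : ∃ δ' : (single A).obj (cokernel ι) ⟶ ((single A).obj Γ)⟦(1 : ℤ)⟧,
      δ = δ' ≫ ((single A).map π)⟦(1 : ℤ)⟧' := by
    obtain ⟨g, hg⟩ : ∃ g : (single A).obj (cokernel ι) ⟶ ((single A).obj Γ)⟦(1 : ℤ)⟧,
        δ = g ≫ (-((single A).map π)⟦(1 : ℤ)⟧') :=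
      Triangle.coyoneda_exact₁ _ (rot_of_distTriang _ (rot_of_distTriang _ hε)) δ hδε
    exact ⟨-g, by rw [hg, Preadditive.comp_neg, Preadditive.neg_comp]⟩
  -- Pulled back to `Γ`, the lift `δ'` lies in Ext¹(Γ, Γ) = 0, so it factors through `δ`. Thus `δ'`
  -- is fixed by `π ≫ a`, and locality of End(Γ) applies to `π ≫ a`.
  obtain ⟨a, ha⟩ : ∃ a : image f ⟶ Γ, δ' = δ ≫ ((single A).map a)⟦(1 : ℤ)⟧' := by
    obtain ⟨g, hg⟩ := Triangle.yoneda_exact₃ _ hδ δ' (hext _)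
    obtain ⟨a, ha⟩ := (single A ⋙ shiftFunctor (Db A) (1 : ℤ)).map_surjective g
    refine ⟨a, hg.trans ?_⟩
    rw [← ha]
    rfl
  obtain h | h := isIso_or_isIso_id_sub k hfin hΓ (π ≫ a)
  · have : Mono π := mono_of_mono π a
    have : Mono f := by rw [← hfac]; exact mono_comp _ _
    exact isIso_of_mono_endo k hfin f
  -- Here `𝟙 Γ - π ≫ a` is invertible and kills `δ'`, so `δ = 0` and C is a summand of the
  -- indecomposable `Γ`: either C = 0 and `f` is epi, or the image of `f` is zero.
  · have h₀ : δ' ≫ ((single A).map (𝟙 Γ - π ≫ a))⟦(1 : ℤ)⟧' = 0 := by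
      rw [Functor.map_sub, Functor.map_sub, Preadditive.comp_sub, Functor.map_comp,
        Functor.map_comp, ← reassoc_of% hδ', ← ha]
      simp
    have hδ'₀ : δ' = 0 := by
      rwa [← cancel_mono (((single A).map (𝟙 Γ - π ≫ a))⟦(1 : ℤ)⟧'), zero_comp]
    have hδ₀ : δ = 0 := by rw [hδ', hδ'₀, zero_comp]
    obtain ⟨s, hs⟩ : ∃ s : cokernel ι ⟶ Γ, s ≫ q = 𝟙 _ := by
      obtain ⟨s, hs⟩ := Triangle.coyoneda_exact₃ _ hδ (𝟙 ((single A).obj (cokernel ι)))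
        ((Category.id_comp _).trans hδ₀)
      obtain ⟨s, rfl⟩ := (single A).map_surjective s
      refine ⟨s, (single A).map_injective ?_⟩
      rw [Functor.map_comp, CategoryTheory.Functor.map_id]
      exact hs.symm
    have hιq : ι ≫ q = 0 := cokernel.condition ι
    obtain h₁ | h₁ := eq_zero_or_eq_id_of_indecomposable hΓ (q ≫ s)
      (by rw [Category.assoc, reassoc_of% hs])
    · have hq : q = 0 := by
        rw [← Category.comp_id q, ← hs, reassoc_of% h₁, zero_comp]
      have : Epi ι := Preadditive.epi_of_cokernel_zero hq
      have : Epi f := by rw [← hfac]; exact epi_comp _ _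
      exact isIso_of_epi_endo k hfin f
    · refine (hf ?_).elim
      rw [← hfac, ← Category.comp_id ι, ← h₁, reassoc_of% hιq, zero_comp, comp_zero]

lemma finrank_end_eq_one_of_homVanishes [IsAlgClosed k] {Γ : A} (hΓ : Indecomposable Γ)
    (hext : HomVanishes ((single A).obj Γ) ((single A).obj Γ) 1) :
    Module.finrank k (Γ ⟶ Γ) = 1 := by
  have := hfin Γ Γ
  refine finrank_endomorphism_eq_one k fun f => ⟨?_, isIso_endo_of_homVanishes hfin hher hΓ hext f⟩
  rintro h rfl
  exact hΓ.1 ((IsZero.iff_id_eq_zero Γ).2 (by rw [← IsIso.hom_inv_id (0 : Γ ⟶ Γ), zero_comp]))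

end Exceptional

/-! ### Shifts of objects of A: degree vanishing and exceptionality -/

section Shifted

variable {k : Type t} [Field k] {A : Type u} [Category.{v} A] [Abelian A]
  [HasDerivedCategory.{w} A]

instance (n : ℤ) : (shifted A n).Additive :=
  inferInstanceAs (single A ⋙ shiftFunctor (Db A) n).Additive

lemma homVanishes_shifted_iff {X Y : A} (a b n p : ℤ) (h : p + a = b + n) :
    HomVanishes ((shifted A a).obj X) ((shifted A b).obj Y) n ↔
      HomVanishes ((single A).obj X) ((single A).obj Y) p :=
  homVanishes_shift_iff a b n p h

lemma homVanishes_shifted_of_lt (X Y : A) {a b n : ℤ} (h : b + n < a) :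
    HomVanishes ((shifted A a).obj X) ((shifted A b).obj Y) n :=
  (homVanishes_shifted_iff a b n (b + n - a) (by lia)).2
    (homVanishes_single_of_neg X Y (by lia))

lemma IsHereditary.homVanishes_shifted (hher : IsHereditary A) (X Y : A) {a b n : ℤ}
    (h : a + 2 ≤ b + n) : HomVanishes ((shifted A a).obj X) ((shifted A b).obj Y) n :=
  (homVanishes_shifted_iff a b n (b + n - a) (by lia)).2 (hher X Y _ (by lia))

lemma isZero_of_isZero_obj {C D : Type*} [Category* C] [Category* D] [Preadditive C]
    [Preadditive D] (F : C ⥤ D) [F.Additive] [F.Faithful] {X : C} (h : IsZero (F.obj X)) :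
    IsZero X := by
  rw [IsZero.iff_id_eq_zero]
  apply F.map_injective
  rw [CategoryTheory.Functor.map_id, F.map_zero, h.eq_of_src (𝟙 _) 0]

lemma eq_of_shifted_iso {X Y : A} {a b : ℤ} (hX : ¬ IsZero X)
    (e : (shifted A a).obj X ≅ (shifted A b).obj Y) : a = b := by
  have key {X Y : A} {a b : ℤ} (hX : ¬ IsZero X) (e : (shifted A a).obj X ≅ (shifted A b).obj Y) :
      a ≤ b := by
    by_contra! h
    apply hX
    apply isZero_of_isZero_obj (shifted A a)
    rw [IsZero.iff_id_eq_zero, ← e.hom_inv_id,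
      homVanishes_zero_iff.1 (homVanishes_shifted_of_lt X Y (n := 0) (by lia)) e.hom, zero_comp]
  refine (key hX e).antisymm (key (fun hY => hX ?_) e.symm)
  exact isZero_of_isZero_obj (shifted A a) (((shifted A b).map_isZero hY).of_iso e)

lemma indecomposable_of_obj {C D : Type*} [Category* C] [Category* D] [Preadditive C]
    [Preadditive D] [HasBinaryBiproducts C] [HasBinaryBiproducts D] (F : C ⥤ D) [F.Additive]
    [F.Faithful] {X : C} (h : Indecomposable (F.obj X)) : Indecomposable X := by
  refine ⟨fun hX => h.1 (F.map_isZero hX), fun Y Z φ => ?_⟩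
  have := preservesBinaryBiproducts_of_preservesBiproducts F
  obtain h | h := h.2 _ _ (F.mapIso φ ≪≫ F.mapBiprod Y Z)
  · exact Or.inl (isZero_of_isZero_obj F h)
  · exact Or.inr (isZero_of_isZero_obj F h)

lemma indecomposable_of_iso {C : Type*} [Category* C] [HasZeroMorphisms C]
    [HasBinaryBiproducts C] {X Y : C} (e : X ≅ Y) (h : Indecomposable X) : Indecomposable Y :=
  ⟨fun hY => h.1 (hY.of_iso e), fun Z W φ => h.2 Z W (e ≪≫ φ)⟩

/-- An indecomposable object `E ≅ Γ[m]`, `Γ ∈ A`, with `Hom(E, E[1]) = 0` is exceptional. -/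
lemma isExceptional_of_iso [IsAlgClosed k] [Linear k A]
    (hfin : ∀ X Y : A, Module.Finite k (X ⟶ Y)) (hher : IsHereditary A) {E : Db A} {Γ : A} {m : ℤ}
    (e : E ≅ (shifted A m).obj Γ) (hE : Indecomposable E) (hext : HomVanishes E E 1) :
    IsExceptional k E := by
  have hΓ : Indecomposable Γ := indecomposable_of_obj (shifted A m) (indecomposable_of_iso e hE)
  have hextΓ : HomVanishes ((single A).obj Γ) ((single A).obj Γ) 1 :=
    (homVanishes_shifted_iff m m 1 1 (by lia)).1 (hext.of_iso e e)
  refine ⟨fun i hi => ?_, ?_⟩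
  · obtain hi | rfl | hi : i < 0 ∨ i = 1 ∨ 2 ≤ i := by lia
    · exact (homVanishes_shifted_of_lt Γ Γ (by lia)).of_iso e.symm e.symm
    · exact hext
    · exact (hher.homVanishes_shifted Γ Γ (by lia)).of_iso e.symm e.symm
  · have hid : 𝟙 E ≠ 0 := fun h => hE.1 ((IsZero.iff_id_eq_zero E).2 h)
    refine finrank_eq_one (𝟙 E) hid fun f => ?_
    have hid' : 𝟙 Γ ≠ 0 := fun h => hΓ.1 ((IsZero.iff_id_eq_zero Γ).2 h)
    obtain ⟨g, hg⟩ := (shifted A m).map_surjective (e.inv ≫ f ≫ e.hom)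
    obtain ⟨c, hc⟩ := (finrank_eq_one_iff_of_nonzero' (𝟙 Γ) hid').1
      (finrank_end_eq_one_of_homVanishes hfin hher hΓ hextΓ) g
    refine ⟨c, ?_⟩
    rw [← hc, Functor.map_smul, CategoryTheory.Functor.map_id] at hg
    have : f = e.hom ≫ (e.inv ≫ f ≫ e.hom) ≫ e.inv := by simp
    rw [this, ← hg]
    simp

end Shifted

/-! ### Triangles: vanishing between outer vertices, shifts, uniqueness of fibres -/

section Triangulated

variable {T : Type u} [Category.{v} T] [Preadditive T] [HasZeroObject T]
  [HasShift T ℤ] [∀ n : ℤ, (shiftFunctor T n).Additive] [Pretriangulated T]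
  {U R V : T} {u : U ⟶ R} {v : R ⟶ V} {w : V ⟶ U⟦(1 : ℤ)⟧}

/-- The vanishing of morphisms between the outer vertices of a triangle `U → R → V → U[1]` whose
middle vertex has no self-extensions. -/
lemma homVanishes_of_triangle (hT : Triangle.mk u v w ∈ distTriang T) (hRR : HomVanishes R R 1)
    (hRV : ∀ p : ℤ, 1 ≤ p → HomVanishes R V p) (hVR : HomVanishes V R 2)
    (hVR' : ∀ p : ℤ, p < 0 → HomVanishes V R p)
    (hVV : ∀ p : ℤ, p < 0 ∨ 2 ≤ p → HomVanishes V V p)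
    (hUV : ∀ p : ℤ, p ≤ 0 → HomVanishes U V p) :
    (∀ p, HomVanishes U V p) ∧ HomVanishes V V 1 ∧ HomVanishes U U 1 ∧
      ∀ p : ℤ, p < 0 → HomVanishes V U p := by
  -- Hom¹(V,V) sits between Hom⁰(U,V) and Hom¹(R,V). Hom¹(U,U) sits between Hom⁰(U,V) and Hom¹(U,R),
  -- the latter between Hom¹(R,R) and Hom²(V,R). Hom^p(V,U) sits between Hom^{p-1}(V,V) and
  -- Hom^p(V,R).
  refine ⟨fun p => ?_, HomVanishes.src₃ hT (m := 0) (by lia) (hUV 0 le_rfl) (hRV 1 le_rfl),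
    HomVanishes.obj₁ hT (m := 0) (by lia) (hUV 0 le_rfl)
      (HomVanishes.src₁ hT (m := 2) (by lia) hRR hVR),
    fun p hp => HomVanishes.obj₁ hT (m := p - 1) (by lia) (hVV _ (Or.inl (by lia))) (hVR' p hp)⟩
  obtain hp | hp : p ≤ 0 ∨ 1 ≤ p := by lia
  · exact hUV p hp
  · exact HomVanishes.src₁ hT (m := p + 1) (by lia) (hRV p hp) (hVV _ (Or.inr (by lia)))

end Triangulated

section Triangles

variable {T : Type u} [Category.{v} T] [Preadditive T] [HasZeroObject T]
  [HasShift T ℤ] [∀ n : ℤ, (shiftFunctor T n).Additive] [Pretriangulated T]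
  {X Y Z : T} {f : X ⟶ Y} {g : Y ⟶ Z} {h : Z ⟶ X⟦(1 : ℤ)⟧}

lemma distinguished_of_iso₃ (hT : Triangle.mk f g h ∈ distTriang T) {Z' : T} (e : Z ≅ Z') :
    Triangle.mk f (g ≫ e.hom) (e.inv ≫ h) ∈ distTriang T := by
  refine isomorphic_distinguished _ hT _
    (Triangle.isoMk _ _ (Iso.refl _) (Iso.refl _) e.symm ?_ ?_ ?_)
  exacts [show f ≫ 𝟙 Y = 𝟙 X ≫ f by simp, show (g ≫ e.hom) ≫ e.inv = 𝟙 Y ≫ g by simp,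
    show (e.inv ≫ h) ≫ (𝟙 X)⟦1⟧' = e.inv ≫ h by simp]

/-- Shifting a triangle by `n` puts the sign (-1)^n on its arrows; the automorphism (-1)^n of the
middle vertex removes it from the first two. -/
lemma exists_distinguished_shift (hT : Triangle.mk f g h ∈ distTriang T) (n : ℤ) :
    ∃ h' : Z⟦n⟧ ⟶ X⟦n⟧⟦(1 : ℤ)⟧, Triangle.mk (f⟦n⟧') (g⟦n⟧') h' ∈ distTriang T := by
  have hs : n.negOnePow * n.negOnePow = 1 := Int.units_mul_self _
  let s : Y⟦n⟧ ≅ Y⟦n⟧ :=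
    { hom := n.negOnePow • 𝟙 _
      inv := n.negOnePow • 𝟙 _
      hom_inv_id := by simp [smul_smul, hs]
      inv_hom_id := by simp [smul_smul, hs] }
  refine ⟨((Triangle.shiftFunctor T n).obj (Triangle.mk f g h)).mor₃, ?_⟩
  refine isomorphic_distinguished _ (Triangle.shift_distinguished _ hT n) _
    (Triangle.isoMk _ _ (Iso.refl _) s (Iso.refl _) ?_ ?_ ?_)
  · change f⟦n⟧' ≫ (n.negOnePow • 𝟙 _) = 𝟙 _ ≫ (n.negOnePow • f⟦n⟧')
    simp
  · change g⟦n⟧' ≫ 𝟙 _ = (n.negOnePow • 𝟙 _) ≫ (n.negOnePow • g⟦n⟧')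
    simp [smul_smul, hs]
  · exact (by simp : ∀ φ : Z⟦n⟧ ⟶ X⟦n⟧⟦(1 : ℤ)⟧, φ ≫ (𝟙 _)⟦(1 : ℤ)⟧' = 𝟙 _ ≫ φ) _

lemma inr_fst_distinguished (X Y : T) :
    Triangle.mk (biprod.inr : Y ⟶ X ⊞ Y) biprod.fst 0 ∈ distTriang T := by
  refine isomorphic_distinguished _ (binaryBiproductTriangle_distinguished Y X) _
    (Triangle.isoMk _ _ (Iso.refl _) (biprod.braiding X Y) (Iso.refl _) ?_ ?_ ?_)
  exacts [show biprod.inr ≫ (biprod.braiding X Y).hom = 𝟙 Y ≫ biprod.inl by ext <;> simp,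
    show biprod.fst ≫ 𝟙 X = (biprod.braiding X Y).hom ≫ biprod.snd by simp,
    show (0 : X ⟶ Y⟦(1 : ℤ)⟧) ≫ (𝟙 _)⟦(1 : ℤ)⟧' = 𝟙 X ≫ (0 : X ⟶ Y⟦(1 : ℤ)⟧) by simp]

lemma nonempty_iso_of_iso₂₃ (hT : Triangle.mk f g h ∈ distTriang T) {X' Z' : T} {f' : X' ⟶ Y}
    {g' : Y ⟶ Z'} {h' : Z' ⟶ X'⟦(1 : ℤ)⟧} (hT' : Triangle.mk f' g' h' ∈ distTriang T)
    (e : Z ≅ Z') (he : g ≫ e.hom = g') : Nonempty (X ≅ X') := by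
  let i := isoTriangleOfIso₁₂ _ _ (rot_of_distTriang _ hT) (rot_of_distTriang _ hT')
    (Iso.refl Y) e (show g ≫ e.hom = 𝟙 Y ≫ g' by rw [he, Category.id_comp])
  exact ⟨(shiftFunctor T (1 : ℤ)).preimageIso (Triangle.π₃.mapIso i)⟩

end Triangles

/-! ### Fibres of morphisms between shifted objects of A -/

section Pure

variable {k : Type t} [Field k] {A : Type u} [Category.{v} A] [Abelian A]
  [HasDerivedCategory.{w} A]

variable (A) in
/-- `X[a][b] ≅ X[a + b]`. -/
def shiftedIso (a b c : ℤ) (h : a + b = c) : shifted A a ⋙ shiftFunctor (Db A) b ≅ shifted A c :=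
  Functor.isoWhiskerLeft (single A) (shiftFunctorAdd' (Db A) a b c h).symm

lemma homVanishes_single_of_iso_biprod {L X Y Z : A} {n : ℤ} (φ : X ≅ Y ⊞ Z)
    (hY : HomVanishes ((single A).obj L) ((single A).obj Y) n)
    (hZ : HomVanishes ((single A).obj L) ((single A).obj Z) n) :
    HomVanishes ((single A).obj L) ((single A).obj X) n := by
  have := preservesBinaryBiproducts_of_preservesBiproducts (single A)
  exact (HomVanishes.obj₂ (binaryBiproductTriangle_distinguished _ _) hY hZ).of_iso (.refl _)
    ((single A).mapIso φ ≪≫ (single A).mapBiprod Y Z).symm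

lemma homVanishes_single_of_biprod_iso {L X Y Z : A} {n : ℤ} (φ : X ≅ Y ⊞ Z)
    (hY : HomVanishes ((single A).obj Y) ((single A).obj L) n)
    (hZ : HomVanishes ((single A).obj Z) ((single A).obj L) n) :
    HomVanishes ((single A).obj X) ((single A).obj L) n := by
  have := preservesBinaryBiproducts_of_preservesBiproducts (single A)
  exact (HomVanishes.src₂ (binaryBiproductTriangle_distinguished _ _) hY hZ).of_iso
    ((single A).mapIso φ ≪≫ (single A).mapBiprod Y Z).symm (.refl _)

section HomFinite

variable [Linear k A] (hfin : ∀ X Y : A, Module.Finite k (X ⟶ Y))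
include hfin

lemma homVanishes_of_indSummands_right (L X : A) (n : ℤ)
    (h : ∀ Γ, IsIndSummand Γ X → HomVanishes ((single A).obj L) ((single A).obj Γ) n) :
    HomVanishes ((single A).obj L) ((single A).obj X) n :=
  of_indSummands k hfin (fun _ hX => homVanishes_of_isZero_right _ ((single A).map_isZero hX) n)
    (fun _ _ _ φ => homVanishes_single_of_iso_biprod φ) X h

lemma homVanishes_of_indSummands_left (L X : A) (n : ℤ)
    (h : ∀ Γ, IsIndSummand Γ X → HomVanishes ((single A).obj Γ) ((single A).obj L) n) :
    HomVanishes ((single A).obj X) ((single A).obj L) n :=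
  of_indSummands k hfin (fun _ hX => homVanishes_of_isZero_left ((single A).map_isZero hX) _ n)
    (fun _ _ _ φ => homVanishes_single_of_biprod_iso φ) X h

lemma exists_isIndSummand_of_retract {U : Db A} {B : A} {n : ℤ} (hB : ¬ IsZero B)
    (r : Retract ((shifted A n).obj B) U) : ∃ S, IsIndSummand S U := by
  obtain ⟨Γ, hΓ⟩ := exists_isIndSummand k hfin hB
  obtain ⟨s⟩ := hΓ.retract
  exact ⟨(shifted A n).obj Γ, indecomposable_obj _ hΓ.1,
    exists_biprod_of_retract ((s.map (shifted A n)).trans r)⟩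

end HomFinite

/-- If `f : L → B` and both `Ext¹(L, L)` and `Ext¹(L, coker f)` vanish, so does `Ext¹(L, B)`. -/
lemma IsHereditary.homVanishes_of_cokernel (hher : IsHereditary A) {L B : A} (f : L ⟶ B)
    (hL : HomVanishes ((single A).obj L) ((single A).obj L) 1)
    (hf : HomVanishes ((single A).obj L) ((single A).obj (cokernel f)) 1) :
    HomVanishes ((single A).obj L) ((single A).obj B) 1 := by
  obtain ⟨ε, hε⟩ := exists_distinguished_of_shortExact
    (shortExact_kernel_of_epi (factorThruImage f))
  obtain ⟨δ, hδ⟩ := exists_distinguished_of_shortExact (shortExact_cokernel_of_mono (image.ι f))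
  exact HomVanishes.obj₂ hδ (HomVanishes.obj₃ hε (m := 2) rfl hL (hher _ _ _ le_rfl))
    (hf.of_iso (.refl _) ((single A).mapIso (cokernelImageι f).symm))

/-- The fibre of `f[j] : L[j] → B[j]` is `ker(f)[j] ⊕ coker(f)[j-1]`. -/
lemma IsHereditary.exists_iso_of_fiber (hher : IsHereditary A) {L B : A} (f : L ⟶ B) (j : ℤ)
    {U : Db A} {u : U ⟶ (shifted A j).obj L} {w : (shifted A j).obj B ⟶ U⟦(1 : ℤ)⟧}
    (hT : Triangle.mk u ((shifted A j).map f) w ∈ distTriang (Db A)) :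
    ∃ X Y : A, Nonempty (U ≅ (shifted A j).obj X ⊞ (shifted A (j - 1)).obj Y) := by
  obtain ⟨ε, hε⟩ := exists_distinguished_of_shortExact
    (shortExact_kernel_of_epi (factorThruImage f))
  obtain ⟨δ, hδ⟩ := exists_distinguished_of_shortExact (shortExact_cokernel_of_mono (image.ι f))
  obtain ⟨ε', hε'⟩ := exists_distinguished_shift hε j
  obtain ⟨δ', hδ'⟩ := exists_distinguished_shift hδ j
  -- The octahedron on L → im f → B presents U as an extension of coker(f)[j-1] by ker(f)[j]; its
  -- class lies in Ext²(coker f, ker f) = 0.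
  have o := Triangulated.someOctahedron' (u₁₂ := (shifted A j).map (factorThruImage f))
    (u₂₃ := (shifted A j).map (image.ι f)) (u₁₃ := (shifted A j).map f)
    (by rw [← Functor.map_comp, image.fac]) hε' (inv_rot_of_distTriang _ hδ') hT
  let e := (shiftedIso A j (-1) (j - 1) rfl).app (cokernel (image.ι f))
  obtain ⟨φ, -, -⟩ := exists_iso_binaryBiproduct_of_distTriang _ o.mem
    (((hher.homVanishes_shifted _ (kernel (factorThruImage f)) (a := j - 1) (b := j) (n := 1)
      (by lia)).of_iso e.symm (.refl _)) _)
  exact ⟨_, _, ⟨φ ≪≫ biprod.mapIso (.refl _) e⟩⟩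

/-- The fibre of a morphism `L[j] → B[j+1]` is of the form `M[j]`. -/
lemma exists_iso_of_fiber_shift {L B : A} (j : ℤ)
    {U R V : Db A} {u : U ⟶ R} {v : R ⟶ V} {w : V ⟶ U⟦(1 : ℤ)⟧}
    (hT : Triangle.mk u v w ∈ distTriang (Db A)) (eR : R ≅ (shifted A j).obj L)
    (eV : V ≅ (shifted A (j + 1)).obj B) :
    ∃ M : A, Nonempty (U ≅ (shifted A j).obj M) := by
  -- In the rotated triangle V[-1] → U → R both outer vertices lie in A[j], which is closed under
  -- extensions.
  have hT' := Triangle.shift_distinguished _ (inv_rot_of_distTriang _ hT) (-j)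
  have e₀ (Y : A) : ((shifted A j).obj Y)⟦-j⟧ ≅ (single A).obj Y :=
    (shiftFunctorCompIsoId (Db A) j (-j) (by lia)).app _
  let eV' : V⟦(-1 : ℤ)⟧⟦-j⟧ ≅ (single A).obj B :=
    (shiftFunctor (Db A) (-j)).mapIso ((shiftFunctor (Db A) (-1 : ℤ)).mapIso eV ≪≫
      (shiftedIso A (j + 1) (-1) j (by lia)).app B) ≪≫ e₀ B
  let eR' : R⟦-j⟧ ≅ (single A).obj L := (shiftFunctor (Db A) (-j)).mapIso eR ≪≫ e₀ L
  obtain ⟨M, ⟨e⟩⟩ := exists_iso_single_of_distinguished hT' eV' eR'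
  exact ⟨M, ⟨((shiftFunctorCompIsoId (Db A) (-j) j (by lia)).app U).symm ≪≫
    (shiftFunctor (Db A) j).mapIso e⟩⟩

end Pure

/-! ### The triangle alg(R) -/

namespace AlgTriangle

open scoped ZeroObject

variable {k : Type t} [Field k] {A : Type u} [Category.{v} A] [Abelian A]
  [HasDerivedCategory.{w} A] {σ : StabilityCondition (Db A)} {R : Db A} (D : AlgTriangle σ R)

/-- The phase of `σ_-(R)`. -/
abbrev phase : ℝ := D.filtration.minPhase

/-- The arrow `R → V` factors through a split epimorphism `σ_-(R) → V`, whose kernel `W` is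
`B₁[j+1]` if `B₀ ≠ 0` and is zero otherwise. -/
lemma exists_fiber : ∃ (W : Db A) (κ : W ⟶ D.filtration.minFactor)
    (ρ : D.filtration.minFactor ⟶ D.V) (c : D.V ⟶ W⟦(1 : ℤ)⟧),
    Triangle.mk κ ρ c ∈ distTriang (Db A) ∧ D.filtration.toMinFactor ≫ ρ = D.v ∧
      Nonempty (Retract D.V D.filtration.minFactor) ∧
      Nonempty (Retract W D.filtration.minFactor) ∧
      (IsZero W ∨ ¬ IsZero D.B₀ ∧ Nonempty (W ≅ (shifted A (D.j + 1)).obj D.B₁)) := by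
  by_cases h : IsZero D.B₀
  · obtain ⟨g, hg⟩ := D.eq_of_isZero h
    refine ⟨0, 0, 𝟙 _ ≫ g.inv, _,
      distinguished_of_iso₃ (contractible_distinguished₁ D.filtration.minFactor) g.symm, ?_,
      ⟨.ofIso g⟩, ⟨⟨0, 0, (isZero_zero _).eq_of_src _ _⟩⟩, Or.inl (isZero_zero _)⟩
    rw [Category.id_comp, ← hg, Category.assoc, g.hom_inv_id, Category.comp_id]
  · obtain ⟨g, hg⟩ := D.eq_of_not_isZero h
    refine ⟨_, biprod.inr ≫ D.isoMin.inv, (D.isoMin.hom ≫ biprod.fst) ≫ g.inv, _,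
      distinguished_of_iso₃ (distinguished_of_iso₂ (inr_fst_distinguished _ _) D.isoMin.symm)
        g.symm, ?_,
      ⟨⟨g.hom ≫ biprod.inl ≫ D.isoMin.inv, (D.isoMin.hom ≫ biprod.fst) ≫ g.inv, by simp⟩⟩,
      ⟨⟨biprod.inr ≫ D.isoMin.inv, D.isoMin.hom ≫ biprod.snd, by simp⟩⟩,
      Or.inr ⟨h, ⟨.refl _⟩⟩⟩
    have := D.comm
    rw [← hg] at this
    rw [← Category.assoc, ← this]
    simp

lemma P_V : σ.P D.phase D.V := by
  obtain ⟨W, κ, ρ, c, -, -, ⟨r⟩, -⟩ := D.exists_fiber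
  exact StabilityCondition.P_of_retract D.filtration.minFactor_mem r

/-- The Harder-Narasimhan triangle `X → R → σ_-(R)` and the induced triangle `X → U → W`. -/
lemma exists_triangles : ∃ (X W : Db A) (x : X ⟶ R) (δ : D.filtration.minFactor ⟶ X⟦(1 : ℤ)⟧)
    (a : X ⟶ D.U) (b : D.U ⟶ W) (c : W ⟶ X⟦(1 : ℤ)⟧),
    Triangle.mk x D.filtration.toMinFactor δ ∈ distTriang (Db A) ∧
      Triangle.mk a b c ∈ distTriang (Db A) ∧ ExtClosure σ.P (Set.Ioi D.phase) X ∧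
      σ.P D.phase W ∧
      (IsZero W ∨ ¬ IsZero D.B₀ ∧ Nonempty (W ≅ (shifted A (D.j + 1)).obj D.B₁)) := by
  obtain ⟨W, κ, ρ, c, hW, hρ, -, ⟨r⟩, hW'⟩ := D.exists_fiber
  obtain ⟨X, x, δ, hX, hX'⟩ := D.filtration.exists_last_triangle
  have o := Triangulated.someOctahedron' hρ hX hW D.distinguished
  exact ⟨X, W, x, δ, _, _, _, hX, o.mem, hX',
    StabilityCondition.P_of_retract D.filtration.minFactor_mem r, hW'⟩

/-- Either `B₀ ≠ 0` and `V ≅ B₀[j]`, or `B₀ = 0` and `V ≅ B₁[j+1]`. -/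
lemma iso_V : (¬ IsZero D.B₀ ∧ Nonempty (D.V ≅ (shifted A D.j).obj D.B₀)) ∨
    IsZero D.B₀ ∧ Nonempty (D.V ≅ (shifted A (D.j + 1)).obj D.B₁) := by
  by_cases h : IsZero D.B₀
  · obtain ⟨g, -⟩ := D.eq_of_isZero h
    exact Or.inr ⟨h, ⟨g ≪≫ D.isoMin ≪≫
      (isoZeroBiprod ((shifted A D.j).map_isZero h)).symm⟩⟩
  · obtain ⟨g, -⟩ := D.eq_of_not_isZero h
    exact Or.inl ⟨h, ⟨g⟩⟩

lemma not_isZero_V : ¬ IsZero D.V := by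
  intro h
  obtain ⟨h₀, ⟨e⟩⟩ | ⟨h₀, -⟩ := D.iso_V
  · exact h₀ (isZero_of_isZero_obj (shifted A D.j) (h.of_iso e.symm))
  · obtain ⟨g, -⟩ := D.eq_of_isZero h₀
    exact D.filtration.minFactor_nonzero (h.of_iso g.symm)

lemma exists_iso_of_retract_V {S : Db A} (r : Retract S D.V) :
    ∃ (Γ : A) (m : ℤ), Nonempty (S ≅ (shifted A m).obj Γ) := by
  obtain ⟨-, ⟨e⟩⟩ | ⟨-, ⟨e⟩⟩ := D.iso_V
  all_goals
    obtain ⟨Γ, h⟩ := exists_iso_of_retract_obj (shifted A _) (r.trans (.ofIso e))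
    exact ⟨Γ, _, h⟩

/-- On the part X of U, phases exceed that of V. The other part W is zero or B₁[j+1], and in the
latter case V ≅ B₀[j] lies in a lower degree. -/
lemma homVanishes_U_V {p : ℤ} (hp : p ≤ 0) : HomVanishes D.U D.V p := by
  obtain ⟨X, W, x, δ, a, b, c, -, hU, hX, hW, hW'⟩ := D.exists_triangles
  refine HomVanishes.src₂ hU (ExtClosure.homVanishes p ?_ hX (.singleton D.P_V)) ?_
  · rintro a (ha : _ < a) _ rfl
    have : (p : ℝ) ≤ 0 := by exact_mod_cast hp
    linarith
  · obtain hW₀ | ⟨h₀, ⟨e⟩⟩ := hW'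
    · exact homVanishes_of_isZero_left hW₀ _ _
    · obtain ⟨-, ⟨e'⟩⟩ | ⟨h, -⟩ := D.iso_V
      · exact (homVanishes_shifted_of_lt _ _ (by lia)).of_iso e.symm e'.symm
      · exact (h₀ h).elim

lemma not_isZero_U (hR : ¬ IsZero R) (hss : ¬ IsSemistable σ R) : ¬ IsZero D.U := by
  intro h
  have : IsIso D.v := (Triangle.isZero₁_iff_isIso₂ _ D.distinguished).1 h
  exact hss ⟨hR, _, σ.P_iso _ (asIso D.v).symm D.P_V⟩

lemma not_isZero_L (hR : ¬ IsZero R) : ¬ IsZero D.L := fun h =>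
  hR (((shifted A D.j).map_isZero h).of_iso D.isoL)

/-- A summand of `U` which is semistable has phase greater than that of `σ_-(R)`. -/
lemma phase_lt_of_retract_U {E : Db A} (hE : ¬ IsZero E) (r : Retract E D.U) {φ : ℝ}
    (hφ : σ.P φ E) : D.phase < φ := by
  by_contra! hle
  obtain ⟨X, W, x, δ, a, b, c, -, hU, hX, hW, hW'⟩ := D.exists_triangles
  -- W = B₁[j+1] has no maps to R ≅ L[j] or to V[-1] ≅ B₀[j-1], hence none to U. If E had phase at
  -- most that of V, X would not map to E either, so the projection U → E would vanish.
  have hWU : HomVanishes W D.U 0 := by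
    obtain hW₀ | ⟨h₀, ⟨e⟩⟩ := hW'
    · exact homVanishes_of_isZero_left hW₀ _ _
    · obtain ⟨-, ⟨e'⟩⟩ | ⟨h, -⟩ := D.iso_V
      · exact HomVanishes.obj₁ D.distinguished (m := -1) (by lia)
          ((homVanishes_shifted_of_lt _ _ (by lia)).of_iso e.symm e'.symm)
          ((homVanishes_shifted_of_lt _ _ (by lia)).of_iso e.symm D.isoL.symm)
      · exact (h₀ h).elim
  have hUE : HomVanishes D.U E 0 := by
    refine HomVanishes.src₂ hU (ExtClosure.homVanishes_zero ?_ hX (.singleton hφ))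
      (hWU.of_retract (.refl _) r)
    rintro a (ha : _ < a) _ rfl
    exact hle.trans_lt ha
  apply hE
  rw [IsZero.iff_id_eq_zero, ← r.retract, homVanishes_zero_iff.1 hUE r.r, comp_zero]

lemma exists_isIndSummand_V [Linear k A]
    (hfin : ∀ X Y : A, Module.Finite k (X ⟶ Y)) : ∃ S, IsIndSummand S D.V := by
  have h := D.not_isZero_V
  obtain ⟨-, ⟨e⟩⟩ | ⟨-, ⟨e⟩⟩ := D.iso_V
  all_goals
    refine exists_isIndSummand_of_retract hfin (fun hB => h ?_) (.ofIso e.symm)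
    exact ((shifted A _).map_isZero hB).of_iso e

section Hereditary

variable (hher : IsHereditary A)
include hher

lemma exists_iso_U : ∃ X Y : A,
    Nonempty (D.U ≅ (shifted A D.j).obj X ⊞ (shifted A (D.j - 1)).obj Y) := by
  obtain ⟨h, -⟩ | ⟨-, ⟨e⟩⟩ := D.iso_V
  · obtain ⟨g, hg⟩ := D.eq_of_not_isZero h
    have hT := distinguished_of_iso₃ (distinguished_of_iso₂ D.distinguished D.isoL) g
    rw [Category.assoc, hg, Iso.inv_hom_id_assoc] at hT
    exact hher.exists_iso_of_fiber D.f₀ D.j hT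
  · obtain ⟨M, ⟨φ⟩⟩ := exists_iso_of_fiber_shift D.j D.distinguished D.isoL e
    exact ⟨M, 0, ⟨φ ≪≫ isoBiprodZero ((shifted A (D.j - 1)).map_isZero (isZero_zero A))⟩⟩

/-- U is a sum of objects of A[j] and A[j-1], and there are no maps from the first to the second, so
an indecomposable summand lives in a single degree. -/
lemma exists_iso_of_retract_U {E : Db A} (hE : Indecomposable E) (r : Retract E D.U) :
    ∃ (Γ : A) (m : ℤ), Nonempty (E ≅ (shifted A m).obj Γ) := by
  obtain ⟨X, Y, ⟨φ⟩⟩ := D.exists_iso_U hher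
  obtain ⟨K, h⟩ | ⟨K, h⟩ := exists_iso_of_retract_biprod (shifted A D.j) (shifted A (D.j - 1)) hE
    (homVanishes_zero_iff.1 (homVanishes_shifted_of_lt X Y (by lia))) (r.trans (.ofIso φ))
  · exact ⟨K, _, h⟩
  · exact ⟨K, _, h⟩

variable [Linear k A] (hfin : ∀ X Y : A, Module.Finite k (X ⟶ Y))
include hfin

lemma exists_isIndSummand_U (hU : ¬ IsZero D.U) : ∃ E, IsIndSummand E D.U := by
  obtain ⟨X, Y, ⟨φ⟩⟩ := D.exists_iso_U hher
  by_cases hX : IsZero X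
  · refine exists_isIndSummand_of_retract hfin (B := Y) (n := D.j - 1) (fun hY => hU ?_)
      ⟨biprod.inr ≫ φ.inv, φ.hom ≫ biprod.snd, by simp⟩
    exact ((biprod_isZero_iff _ _).2 ⟨(shifted A _).map_isZero hX,
      (shifted A _).map_isZero hY⟩).of_iso φ
  · exact exists_isIndSummand_of_retract hfin hX
      ⟨biprod.inl ≫ φ.inv, φ.hom ≫ biprod.fst, by simp⟩

/-- The vanishing of morphisms between the vertices of a triangle `alg(R)` of regular type. -/
lemma homVanishes_of_isRegularType (hR : HomVanishes R R 1) (hD : D.IsRegularType) :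
    (∀ p, HomVanishes D.U D.V p) ∧ HomVanishes D.V D.V 1 ∧ HomVanishes D.U D.U 1 ∧
      ∀ p : ℤ, p < 0 → HomVanishes D.V D.U p := by
  have hL : HomVanishes ((single A).obj D.L) ((single A).obj D.L) 1 :=
    (homVanishes_shifted_iff D.j D.j 1 1 (by lia)).1 (hR.of_iso D.isoL D.isoL)
  obtain ⟨h₀, ⟨e⟩⟩ | ⟨h₀, ⟨e⟩⟩ := D.iso_V
  · have hcoker : HomVanishes ((single A).obj D.L) ((single A).obj (cokernel D.f₀)) 1 := by
      obtain h | h | h := hD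
      · exact homVanishes_of_isZero_right _ ((single A).map_isZero h.2) _
      · exact homVanishes_of_indSummands_right hfin _ _ _ h.2.2
      · exact (h₀ h.1).elim
    have hLB := hher.homVanishes_of_cokernel D.f₀ hL hcoker
    refine homVanishes_of_triangle D.distinguished hR (fun p hp => ?_) ?_ (fun p hp => ?_)
      (fun p hp => ?_) fun p hp => D.homVanishes_U_V hp
    · obtain rfl | hp : p = 1 ∨ 2 ≤ p := by lia
      · exact ((homVanishes_shifted_iff D.j D.j 1 1 (by lia)).2 hLB).of_iso D.isoL.symm e.symm
      · exact (hher.homVanishes_shifted _ _ (by lia)).of_iso D.isoL.symm e.symm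
    · exact (hher.homVanishes_shifted _ _ (by lia)).of_iso e.symm D.isoL.symm
    · exact (homVanishes_shifted_of_lt _ _ (by lia)).of_iso e.symm D.isoL.symm
    · obtain hp | hp := hp
      · exact (homVanishes_shifted_of_lt _ _ (by lia)).of_iso e.symm e.symm
      · exact (hher.homVanishes_shifted _ _ (by lia)).of_iso e.symm e.symm
  · have hBL : HomVanishes ((single A).obj D.B₁) ((single A).obj D.L) 1 := by
      obtain h | h | h := hD
      · exact (h.1 h₀).elim
      · exact (h.1 h₀).elim
      · exact homVanishes_of_indSummands_left hfin _ _ _ h.2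
    refine homVanishes_of_triangle D.distinguished hR (fun p hp => ?_) ?_ (fun p hp => ?_)
      (fun p hp => ?_) fun p hp => D.homVanishes_U_V hp
    · exact (hher.homVanishes_shifted _ _ (by lia)).of_iso D.isoL.symm e.symm
    -- Since V ≅ B₁[j+1] and R ≅ L[j], Hom²(V, R) is Ext¹(B₁, L): the place where C3 enters.
    · exact ((homVanishes_shifted_iff (D.j + 1) D.j 2 1 (by lia)).2 hBL).of_iso e.symm
        D.isoL.symm
    · exact (homVanishes_shifted_of_lt _ _ (by lia)).of_iso e.symm D.isoL.symm
    · obtain hp | hp := hp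
      · exact (homVanishes_shifted_of_lt _ _ (by lia)).of_iso e.symm e.symm
      · exact (hher.homVanishes_shifted _ _ (by lia)).of_iso e.symm e.symm

end Hereditary

section Uniqueness

variable (D' : AlgTriangle σ R) (hR : ¬ IsZero R)
include hR

lemma j_eq : D.j = D'.j :=
  eq_of_shifted_iso (D.not_isZero_L hR) (D.isoL.symm ≪≫ D'.isoL)

/-- No nonzero map goes from B₁[j+1] to B₀'[j], so an isomorphism of minimal factors is triangular
for the decompositions and induces one on the B₀[j] parts. -/
lemma exists_B₀_iso : ∃ e : (shifted A D.j).obj D.B₀ ≅ (shifted A D'.j).obj D'.B₀,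
    (D.isoL.hom ≫ (shifted A D.j).map D.f₀) ≫ e.hom =
      D'.isoL.hom ≫ (shifted A D'.j).map D'.f₀ := by
  have key (D D' : AlgTriangle σ R) (e : D.filtration.minFactor ≅ D'.filtration.minFactor) :
      D.isoMin.hom ≫ biprod.fst ≫ biprod.inl ≫ D.isoMin.inv ≫ e.hom ≫ D'.isoMin.hom ≫
        biprod.fst = e.hom ≫ D'.isoMin.hom ≫ biprod.fst := by
    have h₀ : biprod.inr ≫ D.isoMin.inv ≫ e.hom ≫ D'.isoMin.hom ≫ biprod.fst = 0 :=
      homVanishes_zero_iff.1 (homVanishes_shifted_of_lt D.B₁ D'.B₀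
        (by have := D.j_eq D' hR; lia)) _
    have htot : D.isoMin.hom ≫ (biprod.fst ≫ biprod.inl + biprod.snd ≫ biprod.inr) ≫
        D.isoMin.inv ≫ e.hom ≫ D'.isoMin.hom ≫ biprod.fst = e.hom ≫ D'.isoMin.hom ≫ biprod.fst := by
      rw [biprod.total, Category.id_comp, Iso.hom_inv_id_assoc]
    simpa only [Preadditive.add_comp, Preadditive.comp_add, Category.assoc, h₀, comp_zero,
      add_zero] using htot
  obtain ⟨e, he⟩ := D.filtration.exists_minFactor_iso D'.filtration
  have key' (D D' : AlgTriangle σ R) (e : D.filtration.minFactor ≅ D'.filtration.minFactor) :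
      (biprod.inl ≫ D.isoMin.inv ≫ e.hom ≫ D'.isoMin.hom ≫ biprod.fst) ≫
        biprod.inl ≫ D'.isoMin.inv ≫ e.inv ≫ D.isoMin.hom ≫ biprod.fst = 𝟙 _ := by
    have := key D' D e.symm
    dsimp only [Iso.symm_hom] at this
    simp only [Category.assoc]
    rw [this]
    simp
  refine ⟨⟨biprod.inl ≫ D.isoMin.inv ≫ e.hom ≫ D'.isoMin.hom ≫ biprod.fst,
    biprod.inl ≫ D'.isoMin.inv ≫ e.inv ≫ D.isoMin.hom ≫ biprod.fst, key' D D' e,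
    key' D' D e.symm⟩, ?_⟩
  rw [D.comm, D'.comm]
  simp only [Category.assoc]
  rw [key D D' e, reassoc_of% he]

/-- Finality and the relation R ⇢ (S, E) may be witnessed by different choices of alg(R); this
transfers semistability of summands of U from one to the other. -/
lemma nonempty_U_iso : Nonempty (D.U ≅ D'.U) := by
  obtain ⟨e, he⟩ := D.exists_B₀_iso D' hR
  have hiff : IsZero D.B₀ ↔ IsZero D'.B₀ :=
    ⟨fun h => isZero_of_isZero_obj (shifted A D'.j)
      (((shifted A D.j).map_isZero h).of_iso e.symm),
      fun h => isZero_of_isZero_obj (shifted A D.j) (((shifted A D'.j).map_isZero h).of_iso e)⟩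
  by_cases h : IsZero D.B₀
  · obtain ⟨g, hg⟩ := D.eq_of_isZero h
    obtain ⟨g', hg'⟩ := D'.eq_of_isZero (hiff.1 h)
    obtain ⟨φ, hφ⟩ := D.filtration.exists_minFactor_iso D'.filtration
    refine nonempty_iso_of_iso₂₃ D.distinguished D'.distinguished (g ≪≫ φ ≪≫ g'.symm) ?_
    simp only [Iso.trans_hom, Iso.symm_hom]
    rw [reassoc_of% hg, reassoc_of% hφ, ← hg', Category.assoc, Iso.hom_inv_id, Category.comp_id]
  · obtain ⟨g, hg⟩ := D.eq_of_not_isZero h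
    obtain ⟨g', hg'⟩ := D'.eq_of_not_isZero (mt hiff.2 h)
    refine nonempty_iso_of_iso₂₃ D.distinguished D'.distinguished (g ≪≫ e ≪≫ g'.symm) ?_
    simp only [Iso.trans_hom, Iso.symm_hom]
    rw [reassoc_of% hg]
    simp only [Category.assoc] at he
    rw [reassoc_of% he, ← reassoc_of% hg', Iso.hom_inv_id, Category.comp_id]

end Uniqueness

end AlgTriangle

/-! ### σ-exceptional pairs and termination -/

section Main

variable {k : Type t} [Field k] {A : Type u} [Category.{v} A] [Abelian A]
  [HasDerivedCategory.{w} A] {σ : StabilityCondition (Db A)}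

lemma isSigmaExceptionalPair_of [Linear k A] {S E : Db A} (hS : IsExceptional k S)
    (hE : IsExceptional k E) (hES : ∀ p : ℤ, HomVanishes E S p)
    (hSE : ∀ p : ℤ, p ≤ 0 → HomVanishes S E p) {a b s : ℝ} (ha : σ.P a S) (hb : σ.P b E)
    (hS₀ : ¬ IsZero S) (hE₀ : ¬ IsZero E) (has : a ∈ Set.Ioc s (s + 1))
    (hbs : b ∈ Set.Ioc s (s + 1)) : IsSigmaExceptionalPair k σ S E := by
  refine ⟨⟨?_, ?_⟩, ?_, ?_, s, ![a, b], ?_⟩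
  · simp [Fin.forall_fin_two, hS, hE]
  · intro i j hij p
    fin_cases i <;> fin_cases j
    · exact (lt_irrefl _ hij).elim
    · exact hES p
    · exact absurd hij (by decide)
    · exact (lt_irrefl _ hij).elim
  · simp only [Fin.forall_fin_two]
    exact ⟨⟨hS₀, a, ha⟩, ⟨hE₀, b, hb⟩⟩
  · intro i j hij p hp
    fin_cases i <;> fin_cases j
    · exact (hij rfl).elim
    · exact hSE p hp
    · exact hES p
    · exact (hij rfl).elim
  · simp only [Fin.forall_fin_two]
    exact ⟨⟨ha, has⟩, ⟨hb, hbs⟩⟩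

lemma IsExceptional.not_isZero [Linear k A] {E : Db A} (hE : IsExceptional k E) :
    ¬ IsZero E := by
  intro h
  have : Subsingleton (E ⟶ E) := ⟨fun f g => h.eq_of_src f g⟩
  have := hE.2
  rw [Module.finrank_zero_of_subsingleton] at this
  exact zero_ne_one this

namespace AlgTriangle

variable {R : Db A} (D : AlgTriangle σ R)

/-- If `alg(R)` is of regular type, semistable components of its outer vertices form
`σ`-exceptional pairs up to a shift. -/
lemma exists_isSigmaExceptionalPair [IsAlgClosed k] [Linear k A]
    (hfin : ∀ X Y : A, Module.Finite k (X ⟶ Y)) (hher : IsHereditary A)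
    (hR : HomVanishes R R 1) (hD : D.IsRegularType) {S E : Db A} (hS : IsIndSummand S D.V)
    (hE : IsIndSummand E D.U) (hEss : IsSemistable σ E) :
    ∃ i : ℤ, 1 ≤ i ∧ IsSigmaExceptionalPair k σ S (E⟦-i⟧) := by
  obtain ⟨rS⟩ := hS.retract
  obtain ⟨rE⟩ := hE.retract
  obtain ⟨hE₀, φ, hφ⟩ := hEss
  obtain ⟨hUV, hVV, hUU, hVU⟩ := D.homVanishes_of_isRegularType hher hfin hR hD
  obtain ⟨Γ, m, ⟨e⟩⟩ := D.exists_iso_of_retract_V rS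
  obtain ⟨Γ', m', ⟨e'⟩⟩ := D.exists_iso_of_retract_U hher hE.1 rE
  have hΓ' : Indecomposable Γ' :=
    indecomposable_of_obj (shifted A m') (indecomposable_of_iso e' hE.1)
  have hlt := D.phase_lt_of_retract_U hE₀ rE hφ
  -- This is the shift putting the phase of E[-i] in the interval from `D.phase - 1` (excluded) to
  -- `D.phase` (included), whose right end is the phase of S; `i ≥ 1` because E has the larger
  -- phase.
  obtain ⟨i, hi⟩ : ∃ i : ℤ, i = ⌈φ - D.phase⌉ := ⟨_, rfl⟩
  have hi₁ : 1 ≤ i := by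
    rw [hi, Int.one_le_ceil_iff]
    linarith
  have hi₂ : φ - D.phase ≤ i := hi ▸ Int.le_ceil _
  have hi₃ : (i : ℝ) < φ - D.phase + 1 := hi ▸ Int.ceil_lt_add_one _
  let e'' : E⟦-i⟧ ≅ (shifted A (m' + -i)).obj Γ' :=
    (shiftFunctor (Db A) (-i)).mapIso e' ≪≫ (shiftedIso A m' (-i) _ rfl).app Γ'
  have hind : Indecomposable (E⟦-i⟧) :=
    indecomposable_of_iso e''.symm (indecomposable_obj (shifted A _) hΓ')
  have hEE : HomVanishes E E 1 := hUU.of_retract rE rE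
  refine ⟨i, hi₁, isSigmaExceptionalPair_of (a := D.phase) (b := φ + (-i : ℤ))
    (s := D.phase - 1) (isExceptional_of_iso hfin hher e hS.1 (hVV.of_retract rS rS))
    (isExceptional_of_iso hfin hher e'' hind
      ((homVanishes_shift_iff (-i) (-i) 1 1 (by lia)).2 hEE))
    (fun p => ?_) (fun p hp => ?_) (StabilityCondition.P_of_retract D.P_V rS)
    (σ.P_shift_int hφ (-i)) hS.1.1 hind.1 ?_ ?_⟩
  · exact (homVanishes_shift_left_iff (-i) p (p + i) (by lia)).2 ((hUV _).of_retract rE rS)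
  · exact (homVanishes_shift_right_iff (-i) p (p - i) (by lia)).2
      ((hVU _ (by lia)).of_retract rS rE)
  · constructor <;> linarith
  · push_cast
    constructor <;> linarith

/-- The phases of a component `E` of `U` are phases of `R`; they are fewer unless `B₀ ≠ 0` and the
object `B₀` of `alg(E)` vanishes. -/
lemma ncard_phaseSupport_lt {E : Db A} (r : Retract E D.U) (D' : AlgTriangle σ E)
    (hE : ¬ IsZero E) : (phaseSupport σ E).ncard < (phaseSupport σ R).ncard ∨
      (phaseSupport σ E).ncard ≤ (phaseSupport σ R).ncard ∧ ¬ IsZero D.B₀ ∧ IsZero D'.B₀ := by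
  obtain ⟨X, W, x, δ, a, b, c, hX, hU, hXt, hW, hW'⟩ := D.exists_triangles
  have htR : D.phase ∈ phaseSupport σ R := mem_phaseSupport_of_last_triangle hX
    D.filtration.minFactor_mem hXt D.filtration.minFactor_nonzero
  have hEU : phaseSupport σ E ⊆ phaseSupport σ D.U := phaseSupport_subset_of_retract r
  have hER : phaseSupport σ E ⊆ phaseSupport σ R :=
    (hEU.trans (phaseSupport_subset_insert hU hW hXt)).trans (Set.insert_subset htR
      (phaseSupport_subset_of_last_triangle hX D.filtration.minFactor_mem hXt))
  by_cases ht : D.phase ∈ phaseSupport σ E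
  swap
  · exact Or.inl (Set.ncard_lt_ncard ⟨hER, fun h => ht (h htR)⟩ (finite_phaseSupport R))
  refine Or.inr ⟨Set.ncard_le_ncard hER (finite_phaseSupport R), ?_⟩
  obtain hW₀ | ⟨h₀, ⟨e⟩⟩ := hW'
  -- If W = 0, then U ≅ X has only phases above `D.phase`, which therefore cannot be a phase of E.
  · have : IsIso a := (Triangle.isZero₃_iff_isIso₁ _ hU).1 hW₀
    exact (lt_irrefl _ (lt_of_mem_phaseSupport (hXt.of_iso (asIso a)) (hEU ht))).elim
  refine ⟨h₀, by_contra fun h₀' => D'.not_isZero_V ?_⟩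
  obtain ⟨-, ⟨eV⟩⟩ | ⟨h, -⟩ := D.iso_V
  swap
  · exact (h₀ h).elim
  obtain ⟨-, ⟨eV'⟩⟩ | ⟨h, -⟩ := D'.iso_V
  swap
  · exact (h₀' h).elim
  have hphase : D'.phase ≤ D.phase := le_of_mem_phaseSupport D'.filtration.extClosure_Ici ht
  have hj : D'.j ≤ D.j := by
    by_contra! hlt
    have hEU₀ : HomVanishes E D.U 0 := HomVanishes.obj₁ D.distinguished (m := -1) (by lia)
      ((homVanishes_shifted_of_lt _ _ (by lia)).of_iso D'.isoL.symm eV.symm)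
      ((homVanishes_shifted_of_lt _ _ (by lia)).of_iso D'.isoL.symm D.isoL.symm)
    apply hE
    rw [IsZero.iff_id_eq_zero, ← r.retract, homVanishes_zero_iff.1 hEU₀ r.i, zero_comp]
  -- Assume B₀' ≠ 0, so V' ≅ B₀'[j'] with j' ≤ j. Maps X → V' vanish by phases and maps B₁[j+1] →
  -- B₀'[j'] by degrees. So E → V' is zero, and V' = 0 since Hom(U'[1], V') = 0.
  have hUV' : HomVanishes D.U D'.V 0 := by
    refine HomVanishes.src₂ hU (ExtClosure.homVanishes_zero ?_ hXt (.singleton D'.P_V))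
      ((homVanishes_shifted_of_lt _ _ (by lia)).of_iso e.symm eV'.symm)
    rintro a (ha : _ < a) _ rfl
    exact hphase.trans_lt ha
  have hv : D'.v = 0 := homVanishes_zero_iff.1 (hUV'.of_retract r (.refl _)) _
  rw [IsZero.iff_id_eq_zero]
  exact eq_of_mor₂_comp_eq D'.distinguished (D'.homVanishes_U_V (by lia))
    (by rw [hv, zero_comp, zero_comp])

end AlgTriangle

section Termination

variable [Linear k A] (hfin : ∀ X Y : A, Module.Finite k (X ⟶ Y))
include hfin

/-- If `A` is regularity-preserving, every regular object reaches a final one. -/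
lemma exists_reaches_isFinal (hA : IsRegularityPreserving k A) {R : Db A}
    (hR : IsRegular k σ R) : ∃ R' : Db A, Reaches k σ R R' ∧ IsFinal k σ R' := by
  classical
  obtain ⟨-, -, D, hD⟩ := id hR
  -- The factor 2 lets a drop in the number of phases outweigh the indicator of B₀ ≠ 0 rising from 0
  -- to 1.
  induction hn : 2 * (phaseSupport σ R).ncard + (if IsZero D.B₀ then 0 else 1)
    using Nat.strong_induction_on generalizing R with
  | _ n ih =>
    by_cases hss : ∀ Γ, IsIndSummand Γ D.U → IsSemistable σ Γ
    · exact ⟨R, .refl, hR, D, hD, hss⟩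
    push Not at hss
    obtain ⟨E, hE, hEss⟩ := hss
    obtain ⟨S, hS⟩ := D.exists_isIndSummand_V hfin
    have hY : Yields k σ R S E := ⟨hR, D, hD, hS, hE⟩
    have hEreg := hA σ R S E hR hY hEss
    obtain ⟨-, -, D', hD'⟩ := id hEreg
    obtain ⟨r⟩ := hE.retract
    obtain ⟨R', hreach, hfinal⟩ := ih _ (by
      rw [← hn]
      obtain h | ⟨h, h₀, h₀'⟩ := D.ncard_phaseSupport_lt r D' hE.1.1
      · split_ifs <;> lia
      · simp only [h₀, h₀', if_true, if_false]
        lia) hEreg D' hD' rfl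
    exact ⟨R', .head ⟨S, hY⟩ hreach, hfinal⟩

variable (hher : IsHereditary A)
include hher

lemma IsFinal.exists_yields {R : Db A} (hR : IsFinal k σ R) : ∃ S E, Yields k σ R S E := by
  obtain ⟨⟨hexc, hss, hreg⟩, D, hD, -⟩ := hR
  obtain ⟨S, hS⟩ := D.exists_isIndSummand_V hfin
  obtain ⟨E, hE⟩ := D.exists_isIndSummand_U hher hfin (D.not_isZero_U hexc.not_isZero hss)
  exact ⟨S, E, ⟨hexc, hss, hreg⟩, D, hD, hS, hE⟩

lemma IsFinal.exists_isSigmaExceptionalPair [IsAlgClosed k] {R S E : Db A} (hR : IsFinal k σ R)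
    (hY : Yields k σ R S E) : ∃ i : ℤ, 1 ≤ i ∧ IsSigmaExceptionalPair k σ S (E⟦-i⟧) := by
  obtain ⟨⟨hexc, -, -⟩, D, -, hss⟩ := hR
  obtain ⟨-, D', hD', hS, hE⟩ := hY
  obtain ⟨e⟩ := D.nonempty_U_iso D' hexc.not_isZero
  obtain ⟨hEi, Z, ⟨φ⟩⟩ := id hE
  exact D'.exists_isSigmaExceptionalPair hfin hher (hexc.1 1 one_ne_zero) hD' hS hE
    (hss E ⟨hEi, Z, ⟨e ≪≫ φ⟩⟩)

end Termination

end Main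

end StabExc

end

theorem mainTheorem12 {k : Type t} [Field k] [IsAlgClosed k]
    {A : Type u} [Category.{v} A] [Abelian A] [Linear k A] [HasDerivedCategory.{w} A]
    (hfin : ∀ X Y : A, Module.Finite k (X ⟶ Y)) (hher : StabExc.IsHereditary A)
    (σ : StabExc.StabilityCondition (StabExc.Db A)) :
    (∀ R : StabExc.Db A, StabExc.IsFinal k σ R →
      (∃ S E : StabExc.Db A, StabExc.Yields k σ R S E) ∧
      ∀ S E : StabExc.Db A, StabExc.Yields k σ R S E →
        ∃ i : ℤ, 1 ≤ i ∧ StabExc.IsSigmaExceptionalPair k σ S (E⟦-i⟧)) ∧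
    (StabExc.IsRegularityPreserving k A →
      ∀ R : StabExc.Db A, StabExc.IsRegular k σ R →
        ∃ R' : StabExc.Db A, StabExc.Reaches k σ R R' ∧ StabExc.IsFinal k σ R' ∧
          ∃ S E : StabExc.Db A, StabExc.Yields k σ R' S E ∧
            ∃ i : ℤ, 1 ≤ i ∧ StabExc.IsSigmaExceptionalPair k σ S (E⟦-i⟧)) := by
  have pair (R : StabExc.Db A) (hR : StabExc.IsFinal k σ R) :
      (∃ S E, StabExc.Yields k σ R S E) ∧ ∀ S E, StabExc.Yields k σ R S E →
        ∃ i : ℤ, 1 ≤ i ∧ StabExc.IsSigmaExceptionalPair k σ S (E⟦-i⟧) :=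
    ⟨hR.exists_yields hfin hher, fun _ _ => hR.exists_isSigmaExceptionalPair hfin hher⟩
  refine ⟨pair, fun hA R hR => ?_⟩
  obtain ⟨R', hreach, hfinal⟩ := StabExc.exists_reaches_isFinal hfin hA hR
  obtain ⟨⟨S, E, hY⟩, hpair⟩ := pair R' hfinal
  exact ⟨R', hreach, hfinal, S, E, hY, hpair S E hY⟩
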